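/- Let $M$ and $B$ be smooth manifolds (Hausdorff, second countable, finite-dimensional, without boundary, possibly non-compact), and let $\pi\colon M\to B$ be a smooth surjective submersion with vertical tangent bundle $T_VM=\ker d\pi$, equipped with a smooth vertical metric $g_V$ (a smooth inner product on $T_VM$). For $b\in B$ the fibre $M_b=\pi^{-1}(b)$ carries the (not necessarily complete) Riemannian metric $g_b=g_V|_{M_b}$ with Riemannian measure $\mathrm{dvol}_b$. Let $E\to M$ be a smooth complex vector bundle with a smooth hermitian structure, put $E_b=L^2(M_b,E|_{M_b})$, and let $\Gamma_0(B,E_\bullet)$ be the Hilbert $C_0(B)$-module obtained by completing $\Gamma_c^\infty(M,E)$ with respect to the inner product $\langle\phi|\psi\rangle(b)=\int_{M_b}\langle\phi(y)|\psi(y)\rangle\,\mathrm{dvol}_b(y)$; its elements are families $\psi=(\psi(b))_{b\in B}$ with $\psi(b)\in E_b$, and $\mathrm{ev}_b(\psi):=\psi(b)$. Let $\mathcal D$ be a first-order differential operator on the smooth sections of $E$ which is symmetric, i.e. $\langle\mathcal D\phi|\psi\rangle=\langle\phi|\mathcal D\psi\rangle$ for all $\phi,\psi\in\Gamma_c^\infty(M,E)$,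 and vertically elliptic: it is $C^\infty(B)$-linear, and for every $x\in M$ its principal symbol $\sigma_{\mathcal D}(\xi)(x)\colon E_x\to E_x$ (where $\sigma_{\mathcal D}(df)=[\mathcal D,f]$) is invertible for every nonzero vertical covector $\xi\in (T_V^*M)_x$. Write $\mathcal D$ also for the closure of the operator $\mathcal D$ on $\Gamma_0(B,E_\bullet)$ with initial domain $\Gamma_c^\infty(M,E)$, with adjoint $\mathcal D^*$; and for $b\in B$ write $\mathcal D_b$ for the closure of the operator on $E_b$ to which $\mathcal D$ restricts, with initial domain $\Gamma_c^\infty(M_b,E|_{M_b})$, and $\mathcal D_b^*$ for its adjoint. A closed, densely defined operator $T$ on a Hilbert module is regular if $T^*$ is densely defined and $1+T^*T$ has dense range. Then the following statements are equivalent: 1. $\mathcal D$ is a regular operator on $\Gamma_0(B,E_\bullet)$; 2. for each $b\in B$, the subspace $\mathrm{ev}_b(\mathrm{Dom}\,\mathcal D^*)\subset \mathrm{Dom}\,\mathcal D_b^*$ is a core for $\mathcal D_b^*$; 3. for each $b\in B$, $\mathrm{ev}_b(\mathrm{Dom}\,\mathcal D^*)=\mathrm{Dom}\,\mathcal D_b^*$.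 -/

import Mathlib

open MeasureTheory
open scoped Manifold ContDiff InnerProductSpace

noncomputable section

namespace VerticalOperator

section Geometry

variable (m n : ℕ) {M B : Type*}
  [TopologicalSpace M] [ChartedSpace (EuclideanSpace ℝ (Fin m)) M] [IsManifold (𝓡 m) ∞ M]
  [TopologicalSpace B] [ChartedSpace (EuclideanSpace ℝ (Fin n)) B]

/-- A smooth surjective submersion of an `m`-dimensional manifold onto an `n`-dimensional one. -/
structure IsSurjectiveSubmersion (π : M → B) : Prop where
  smooth : ContMDiff (𝓡 m) (𝓡 n) ∞ π
  surjective : Function.Surjective π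
  surjective_mfderiv : ∀ x, Function.Surjective (mfderiv (𝓡 m) (𝓡 n) π x)

/-- The fibre `M_b = π⁻¹(b)`, with the subspace topology. -/
abbrev Fibre (π : M → B) (b : B) : Type _ := {x : M // π x = b}

/-- The vertical tangent space `(T_V M)_x = ker dπ(x)`. -/
def VerticalSpace (π : M → B) (x : M) : Submodule ℝ (TangentSpace (𝓡 m) x) :=
  LinearMap.ker (mfderiv (𝓡 m) (𝓡 n) π x).toLinearMap

/-- A smooth vertical metric: an inner product on each vertical tangent space which depends
smoothly on the point, i.e. is smooth on pairs of smooth vertical vector fields. -/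
structure VerticalMetric (π : M → B) where
  inner : ∀ x, VerticalSpace m n π x →ₗ[ℝ] VerticalSpace m n π x →ₗ[ℝ] ℝ
  symm : ∀ x v w, inner x v w = inner x w v
  pos : ∀ x v, v ≠ 0 → 0 < inner x v v
  smooth : ∀ X Y : ∀ x, VerticalSpace m n π x,
    ContMDiff (𝓡 m) (𝓡 m).tangent ∞
      (fun x => (⟨x, (X x).1⟩ : TangentBundle (𝓡 m) M)) →
    ContMDiff (𝓡 m) (𝓡 m).tangent ∞
      (fun x => (⟨x, (Y x).1⟩ : TangentBundle (𝓡 m) M)) →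
    ContMDiff (𝓡 m) 𝓘(ℝ, ℝ) ∞ (fun x => inner x (X x) (Y x))

/-- A chart of the fibre `M_b`, as an embedded submanifold of `M` of dimension `m - n`: a
homeomorphism between an open subset of `M_b` and an open subset of `ℝ^(m-n)` whose inverse is
smooth as a map into `M`, and which is the restriction of a smooth map defined on a neighbourhood
in `M` of any point of its domain. -/
structure FibreChart (π : M → B) (b : B) where
  toHomeo : OpenPartialHomeomorph (Fibre π b) (EuclideanSpace ℝ (Fin (m - n)))
  smooth_symm : ContMDiffOn (𝓡 (m - n)) (𝓡 m) ∞
    (fun y => (toHomeo.symm y : Fibre π b).1) toHomeo.target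
  smooth : ∀ x ∈ toHomeo.source, ∃ r : M → EuclideanSpace ℝ (Fin (m - n)),
    ContMDiffAt (𝓡 m) (𝓡 (m - n)) ∞ r x.1 ∧ ∀ y ∈ toHomeo.source, r y.1 = toHomeo y

variable {m n}

/-- The coordinate vector `∂/∂yᵢ` of a fibre chart at the point with coordinates `y`. -/
def FibreChart.coordVec {π : M → B} {b : B} (c : FibreChart m n π b)
    (y : EuclideanSpace ℝ (Fin (m - n))) (i : Fin (m - n)) :
    TangentSpace (𝓡 m) (c.toHomeo.symm y : Fibre π b).1 :=
  mfderiv (𝓡 (m - n)) (𝓡 m) (fun z => (c.toHomeo.symm z : Fibre π b).1) y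
    (EuclideanSpace.single i (1 : ℝ) : EuclideanSpace ℝ (Fin (m - n)))

open Classical in
/-- The metric `g_V` evaluated on two tangent vectors of `M` (and `0` unless both are vertical). -/
def VerticalMetric.eval {π : M → B} (g : VerticalMetric m n π) {x : M}
    (v w : TangentSpace (𝓡 m) x) : ℝ :=
  if h : v ∈ VerticalSpace m n π x ∧ w ∈ VerticalSpace m n π x then
    g.inner x ⟨v, h.1⟩ ⟨w, h.2⟩ else 0

/-- The Riemannian density `√(det g_b(∂ᵢ, ∂ⱼ))` in a chart of the fibre. -/
def VerticalMetric.density {π : M → B} (g : VerticalMetric m n π) {b : B}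
    (c : FibreChart m n π b) (y : EuclideanSpace ℝ (Fin (m - n))) : ℝ :=
  Real.sqrt (Matrix.of fun i j => g.eval (c.coordVec y i) (c.coordVec y j)).det

variable [MeasurableSpace M]

/-- The Riemannian volume of the domain of a chart of `M_b`, as a measure on `M_b`: the
image of `√(det g_b(∂ᵢ, ∂ⱼ)) dy` on the open set of coordinates. -/
def VerticalMetric.chartVolume {π : M → B} (g : VerticalMetric m n π) {b : B}
    (c : FibreChart m n π b) : Measure (Fibre π b) :=
  Measure.map c.toHomeo.symm
    ((volume.restrict c.toHomeo.target).withDensity fun y => ENNReal.ofReal (g.density c y))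

/-- The Riemannian measure `dvol_b` of the fibre `(M_b, g_b)`. The measures `chartVolume g c`
agree on overlaps of charts, so that their supremum is the unique measure whose restriction to
the domain of each chart `c` is `chartVolume g c`. -/
def VerticalMetric.vol {π : M → B} (g : VerticalMetric m n π) (b : B) : Measure (Fibre π b) :=
  ⨆ c : FibreChart m n π b, g.chartVolume c

end Geometry

section Sections

variable {m n : ℕ} {M B : Type*}
  [TopologicalSpace M] [ChartedSpace (EuclideanSpace ℝ (Fin m)) M] [IsManifold (𝓡 m) ∞ M]
  [TopologicalSpace B] [ChartedSpace (EuclideanSpace ℝ (Fin n)) B]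
  (F : Type*) [NormedAddCommGroup F] [NormedSpace ℂ F]
  (E : M → Type*) [TopologicalSpace (Bundle.TotalSpace F E)]
  [∀ x, NormedAddCommGroup (E x)] [∀ x, InnerProductSpace ℂ (E x)]
  [FiberBundle F E] [VectorBundle ℂ F E]

variable (m) in
/-- The inner products of the fibres form a smooth hermitian structure on the bundle: in any of
the local trivialisations, the inner product of two constant vectors is a smooth function. -/
class SmoothHermitian : Prop where
  smooth : ∀ (x₀ : M) (v w : F), ContMDiffOn (𝓡 m) 𝓘(ℝ, ℂ) ∞
    (fun x => ⟪(trivializationAt F E x₀).symmL ℂ x v, (trivializationAt F E x₀).symmL ℂ x w⟫_ℂ)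
    (trivializationAt F E x₀).baseSet

/-! ### Smooth sections and differential operators -/

section Smooth

variable [VectorBundle ℝ F E]

variable (m) in
/-- The space `Γ^∞(M, E)` of smooth sections. -/
def SmoothSections : Submodule ℂ (∀ x, E x) where
  carrier := {s | ContMDiff (𝓡 m) ((𝓡 m).prod 𝓘(ℝ, F)) ∞
    (fun x => Bundle.TotalSpace.mk' F x (s x))}
  add_mem' hs ht := hs.add_section ht
  zero_mem' := Bundle.contMDiff_zeroSection ℝ E
  smul_mem' c s hs := by
    intro x₀
    have h := hs x₀
    rw [Bundle.contMDiffAt_section] at h ⊢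
    have h2 : ContMDiffAt (𝓡 m) 𝓘(ℝ, F) ∞
        (fun x => c • (trivializationAt F E x₀ ⟨x, s x⟩).2) x₀ :=
      ((c • ContinuousLinearMap.id ℝ F).contMDiff.contMDiffAt).comp x₀ h
    refine h2.congr_of_eventuallyEq ?_
    filter_upwards [(trivializationAt F E x₀).open_baseSet.mem_nhds
      (FiberBundle.mem_baseSet_trivializationAt' x₀)] with x hx
    exact ((trivializationAt F E x₀).linear ℂ hx).2 c (s x)

variable {F E}

/-- The product `f s` of a smooth real function and a smooth section. -/
def fmul (f : M → ℝ) (hf : ContMDiff (𝓡 m) 𝓘(ℝ, ℝ) ∞ f)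
    (s : SmoothSections m F E) : SmoothSections m F E :=
  ⟨fun x => (f x : ℂ) • s.1 x, by
    have h : ContMDiff (𝓡 m) ((𝓡 m).prod 𝓘(ℝ, F)) ∞
      (fun x => Bundle.TotalSpace.mk' F x (s.1 x)) := s.2
    have := hf.smul_section h
    exact this⟩

variable (m F E) in
/-- The space `Γ_c^∞(M, E)` of smooth sections with compact support. -/
def CompactSections : Submodule ℂ (SmoothSections m F E) where
  carrier := {s | IsCompact (closure {x | s.1 x ≠ 0})}
  add_mem' {s t} hs ht := by
    refine (hs.union ht).of_isClosed_subset isClosed_closure ?_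
    rw [← closure_union]
    refine closure_mono fun x hx => ?_
    by_contra h
    simp only [Set.mem_union, Set.mem_ofPred_eq, not_or, not_not] at h
    exact hx (by simp [h.1, h.2])
  zero_mem' := by simp
  smul_mem' c s hs := by
    refine hs.of_isClosed_subset isClosed_closure (closure_mono fun x hx h => hx ?_)
    simp [h]

/-- The commutator `[D, f] s = D (f s) - f (D s)`. -/
def commutator (D : SmoothSections m F E →ₗ[ℂ] SmoothSections m F E)
    (f : M → ℝ) (hf : ContMDiff (𝓡 m) 𝓘(ℝ, ℝ) ∞ f) (s : SmoothSections m F E) :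
    SmoothSections m F E :=
  D (fmul f hf s) - fmul f hf (D s)

/-- `D` is a differential operator of order (at most) one: all commutators `[D, f]` with smooth
functions are linear over the smooth functions. -/
def IsFirstOrder (D : SmoothSections m F E →ₗ[ℂ] SmoothSections m F E) : Prop :=
  ∀ (f : M → ℝ) (hf : ContMDiff (𝓡 m) 𝓘(ℝ, ℝ) ∞ f)
    (h : M → ℝ) (hh : ContMDiff (𝓡 m) 𝓘(ℝ, ℝ) ∞ h) (s : SmoothSections m F E),
    commutator D f hf (fmul h hh s) = fmul h hh (commutator D f hf s)

variable (n) in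
/-- `D` is vertical, i.e. linear over the smooth functions on the base. -/
def IsVertical (π : M → B) (D : SmoothSections m F E →ₗ[ℂ] SmoothSections m F E) : Prop :=
  ∀ f : B → ℝ, ContMDiff (𝓡 n) 𝓘(ℝ, ℝ) ∞ f →
    ∀ (hf : ContMDiff (𝓡 m) 𝓘(ℝ, ℝ) ∞ (f ∘ π)) (s : SmoothSections m F E),
      D (fmul (f ∘ π) hf s) = fmul (f ∘ π) hf (D s)

/-- The value at `x` of the principal symbol of `D` on the covector `df(x)` is the
endomorphism `σ` of `E x`. -/
def IsSymbolAt (D : SmoothSections m F E →ₗ[ℂ] SmoothSections m F E)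
    (f : M → ℝ) (hf : ContMDiff (𝓡 m) 𝓘(ℝ, ℝ) ∞ f) (x : M) (σ : E x →ₗ[ℂ] E x) : Prop :=
  ∀ s : SmoothSections m F E, (commutator D f hf s).1 x = σ (s.1 x)

variable (n) in
/-- `D` is vertically elliptic: it is vertical and its principal symbol at every point is
invertible on every covector `df(x)` whose restriction to the vertical tangent space is nonzero. -/
def IsVerticallyElliptic (π : M → B)
    (D : SmoothSections m F E →ₗ[ℂ] SmoothSections m F E) : Prop :=
  IsVertical n π D ∧
  ∀ (x : M) (f : M → ℝ) (hf : ContMDiff (𝓡 m) 𝓘(ℝ, ℝ) ∞ f),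
    (∃ v ∈ VerticalSpace m n π x, mfderiv (𝓡 m) 𝓘(ℝ, ℝ) f x v ≠ 0) →
    ∃ σ : E x ≃ₗ[ℂ] E x, IsSymbolAt D f hf x σ.toLinearMap

/-- `D` is symmetric on `Γ_c^∞(M, E)` for the inner product given by integration along the
fibres, `⟨φ|ψ⟩(b) = ∫_{M_b} ⟨φ(y)|ψ(y)⟩ dvol_b(y)`. -/
def IsFibrewiseSymmetric [MeasurableSpace M] {π : M → B} (g : VerticalMetric m n π)
    (D : SmoothSections m F E →ₗ[ℂ] SmoothSections m F E) : Prop :=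
  ∀ φ ∈ CompactSections m F E, ∀ ψ ∈ CompactSections m F E, ∀ b : B,
    ∫ y : Fibre π b, ⟪(D φ).1 y.1, ψ.1 y.1⟫_ℂ ∂(g.vol b)
      = ∫ y : Fibre π b, ⟪φ.1 y.1, (D ψ).1 y.1⟫_ℂ ∂(g.vol b)

end Smooth

/-! ### The Hilbert spaces `L²(M_b, E_b)` -/

section L2

variable [SecondCountableTopology M] [MeasurableSpace M] [BorelSpace M] [FiniteDimensional ℂ F]
  {π : M → B}

/-- Almost everywhere measurability of a section of `E_b` over `M_b`: its components in all the
local trivialisations of `E` (extended by zero) are almost everywhere measurable. -/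
def MeasurableSection {b : B} (μ : Measure (Fibre π b)) (s : ∀ y : Fibre π b, E y.1) : Prop :=
  ∀ x₀ : M, AEStronglyMeasurable
    (fun y : Fibre π b => (trivializationAt F E x₀).continuousLinearMapAt ℂ y.1 (s y)) μ

variable {F E}

theorem MeasurableSection.aestronglyMeasurable_inner [SmoothHermitian m F E]
    {b : B} {μ : Measure (Fibre π b)} {s t : ∀ y : Fibre π b, E y.1}
    (hs : MeasurableSection F E μ s) (ht : MeasurableSection F E μ t) :
    AEStronglyMeasurable (fun y => ⟪s y, t y⟫_ℂ) μ := by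
  obtain ⟨S, hS, hcov⟩ := TopologicalSpace.countable_cover_nhds
    (f := fun x₀ : M => (trivializationAt F E x₀).baseSet)
    (fun x₀ => (trivializationAt F E x₀).open_baseSet.mem_nhds
      (FiberBundle.mem_baseSet_trivializationAt' x₀))
  have : Countable S := hS.to_subtype
  let U : S → Set (Fibre π b) := fun x₀ => Subtype.val ⁻¹' (trivializationAt F E x₀.1).baseSet
  have hU : (⋃ x₀, U x₀) = Set.univ := by
    ext y
    have : y.1 ∈ ⋃ x ∈ S, (trivializationAt F E x).baseSet := by rw [hcov]; trivial
    simpa [U] using this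
  rw [← Measure.restrict_univ (μ := μ), ← hU, aestronglyMeasurable_iUnion_iff]
  intro x₀
  have hUo : IsOpen (U x₀) :=
    (trivializationAt F E x₀.1).open_baseSet.preimage continuous_subtype_val
  let e := trivializationAt F E x₀.1
  let bF := Module.finBasis ℂ F
  have hcoord : ∀ (r : ∀ y : Fibre π b, E y.1), MeasurableSection F E μ r → ∀ i,
      AEStronglyMeasurable (fun y => bF.repr (e.continuousLinearMapAt ℂ y.1 (r y)) i)
        (μ.restrict (U x₀)) := fun r hr i =>
    ((bF.coord i).continuous_of_finiteDimensional.comp_aestronglyMeasurable (hr x₀.1)).restrict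
  have hG : ∀ i j, AEStronglyMeasurable
      (fun y : Fibre π b => ⟪e.symmL ℂ y.1 (bF i), e.symmL ℂ y.1 (bF j)⟫_ℂ)
        (μ.restrict (U x₀)) := fun i j =>
    ContinuousOn.aestronglyMeasurable
      (((SmoothHermitian.smooth (m := m) x₀.1 (bF i) (bF j)).continuousOn).comp
        continuous_subtype_val.continuousOn fun y hy => hy) hUo.measurableSet
  have hsum : AEStronglyMeasurable (fun y : Fibre π b => ∑ i, ∑ j,
      (starRingEnd ℂ) (bF.repr (e.continuousLinearMapAt ℂ y.1 (s y)) i) *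
        (bF.repr (e.continuousLinearMapAt ℂ y.1 (t y)) j *
          ⟪e.symmL ℂ y.1 (bF i), e.symmL ℂ y.1 (bF j)⟫_ℂ)) (μ.restrict (U x₀)) := by
    refine Finset.aestronglyMeasurable_fun_sum _ fun i _ =>
      Finset.aestronglyMeasurable_fun_sum _ fun j _ => ?_
    exact (Complex.continuous_conj.comp_aestronglyMeasurable (hcoord s hs i)).mul
      ((hcoord t ht j).mul (hG i j))
  refine hsum.congr ?_
  filter_upwards [ae_restrict_mem hUo.measurableSet] with y hy
  have key : ∀ v : E y.1, v = ∑ i, bF.repr (e.continuousLinearMapAt ℂ y.1 v) i •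
      e.symmL ℂ y.1 (bF i) := fun v => by
    conv_lhs => rw [← e.symmL_continuousLinearMapAt (R := ℂ) hy v,
      ← bF.sum_repr (e.continuousLinearMapAt ℂ y.1 v)]
    simp only [map_sum, map_smul]
  conv_rhs => rw [key (s y), key (t y)]
  simp only [sum_inner, inner_sum, inner_smul_left, inner_smul_right, Finset.mul_sum]
  rw [Finset.sum_comm]
  exact Finset.sum_congr rfl fun i _ => Finset.sum_congr rfl fun j _ => by ring

theorem MeasurableSection.aestronglyMeasurable_norm [SmoothHermitian m F E]
    {b : B} {μ : Measure (Fibre π b)} {s : ∀ y : Fibre π b, E y.1}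
    (hs : MeasurableSection F E μ s) : AEStronglyMeasurable (fun y => ‖s y‖) μ := by
  have h := hs.aestronglyMeasurable_inner (m := m) hs
  have h2 := Real.continuous_sqrt.comp_aestronglyMeasurable
    (Complex.continuous_re.comp_aestronglyMeasurable h)
  refine h2.congr (Filter.Eventually.of_forall fun y => ?_)
  exact (norm_eq_sqrt_re_inner (𝕜 := ℂ) (s y)).symm

variable (F E)
variable [SmoothHermitian m F E] (g : VerticalMetric m n π) (b : B)

/-- The measurable square-integrable sections of `E_b` over `M_b`. -/
def SquareIntegrableSections : Submodule ℂ (∀ y : Fibre π b, E y.1) where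
  carrier := {s | MeasurableSection F E (g.vol b) s ∧ MemLp (fun y => ‖s y‖) 2 (g.vol b)}
  add_mem' {s t} hs ht := by
    have hm : MeasurableSection F E (g.vol b) (s + t) := fun x₀ => by
      exact ((hs.1 x₀).add (ht.1 x₀)).congr (Filter.Eventually.of_forall fun y => by simp)
    exact ⟨hm, (hs.2.add ht.2).mono (hm.aestronglyMeasurable_norm (m := m))
      (Filter.Eventually.of_forall fun y => by
        simpa [abs_of_nonneg, add_nonneg] using norm_add_le (s y) (t y))⟩
  zero_mem' := ⟨fun x₀ => by simpa using aestronglyMeasurable_const, by simp⟩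
  smul_mem' c s hs := ⟨fun x₀ =>
      ((hs.1 x₀).const_smul c).congr (Filter.Eventually.of_forall fun y => by simp), by
    simpa [norm_smul] using hs.2.const_mul ‖c‖⟩

/-- The square-integrable sections of `E_b`, as a semi-inner product space. -/
def FibreL2Pre : Type _ := SquareIntegrableSections F E g b

instance : AddCommGroup (FibreL2Pre F E g b) :=
  inferInstanceAs (AddCommGroup (SquareIntegrableSections F E g b))

instance : Module ℂ (FibreL2Pre F E g b) :=
  inferInstanceAs (Module ℂ (SquareIntegrableSections F E g b))

variable {F E g b} in
theorem FibreL2Pre.integrable_inner (s t : FibreL2Pre F E g b) :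
    Integrable (fun y => ⟪s.1 y, t.1 y⟫_ℂ) (g.vol b) :=
  (s.2.2.integrable_mul t.2.2).mono (s.2.1.aestronglyMeasurable_inner (m := m) t.2.1)
    (Filter.Eventually.of_forall fun y => by
      simpa using norm_inner_le_norm (𝕜 := ℂ) (s.1 y) (t.1 y))

/-- The semi-inner product `⟨s|t⟩ = ∫_{M_b} ⟨s(y)|t(y)⟩ dvol_b(y)`. -/
instance : PreInnerProductSpace.Core ℂ (FibreL2Pre F E g b) where
  inner s t := ∫ y, ⟪s.1 y, t.1 y⟫_ℂ ∂(g.vol b)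
  conj_inner_symm s t := by
    rw [← integral_conj]
    exact integral_congr_ae (Filter.Eventually.of_forall fun y => inner_conj_symm _ _)
  re_inner_nonneg s := by
    rw [← integral_re (s.integrable_inner s)]
    exact integral_nonneg fun y => inner_self_nonneg
  add_left r s t := by
    rw [← integral_add (r.integrable_inner t) (s.integrable_inner t)]
    exact integral_congr_ae (Filter.Eventually.of_forall fun y => inner_add_left _ _ _)
  smul_left s t c := by
    rw [← integral_const_mul]
    exact integral_congr_ae (Filter.Eventually.of_forall fun y => inner_smul_left _ _ _)

instance : SeminormedAddCommGroup (FibreL2Pre F E g b) :=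
  InnerProductSpace.Core.toSeminormedAddCommGroup (𝕜 := ℂ)

instance : InnerProductSpace ℂ (FibreL2Pre F E g b) :=
  InnerProductSpace.ofCore (inferInstance : PreInnerProductSpace.Core ℂ (FibreL2Pre F E g b))

/-- The Hilbert space `E_b = L²(M_b, E_b)`: square-integrable sections modulo the sections of
norm zero, i.e. those vanishing almost everywhere. -/
abbrev FibreL2 : Type _ := SeparationQuotient (FibreL2Pre F E g b)

variable {F E g b} in
/-- The element `u` of `L²(M_b, E_b)` is the class of the restriction `s|_{M_b}` of the smooth
section `s` of `E`. -/
def IsClassOf [VectorBundle ℝ F E] (u : FibreL2 F E g b) (s : SmoothSections m F E) : Prop :=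
  ∃ r : FibreL2Pre F E g b, (∀ y, r.1 y = s.1 y.1) ∧ SeparationQuotient.mk r = u

section

variable {F E g b} [VectorBundle ℝ F E]

theorem IsClassOf.add {u v : FibreL2 F E g b} {s t : SmoothSections m F E}
    (hu : IsClassOf u s) (hv : IsClassOf v t) : IsClassOf (u + v) (s + t) := by
  obtain ⟨p, hp, rfl⟩ := hu
  obtain ⟨q, hq, rfl⟩ := hv
  exact ⟨p + q, fun y => congrArg₂ (· + ·) (hp y) (hq y), rfl⟩

theorem IsClassOf.smul (c : ℂ) {u : FibreL2 F E g b} {s : SmoothSections m F E}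
    (hu : IsClassOf u s) : IsClassOf (c • u) (c • s) := by
  obtain ⟨p, hp, rfl⟩ := hu
  exact ⟨c • p, fun y => congrArg (c • ·) (hp y), rfl⟩

theorem IsClassOf.zero : IsClassOf (0 : FibreL2 F E g b) (0 : SmoothSections m F E) :=
  ⟨0, fun _ => rfl, rfl⟩

end

end L2
end Sections

/-! ### Unbounded operators on Hilbert spaces and on Hilbert modules of sections

Operators are partially defined linear maps; `Submodule.toLinearPMap` turns a graph into the
operator with that graph. -/

section Operators

/-- The adjoint of an operator `A` on an inner product space, `u ∈ Dom A*` and `A* u = v` iff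
`⟨A x|u⟩ = ⟨x|v⟩` for all `x ∈ Dom A`. -/
def hilbertAdjoint {H : Type*} [NormedAddCommGroup H] [InnerProductSpace ℂ H]
    (A : H →ₗ.[ℂ] H) : H →ₗ.[ℂ] H :=
  Submodule.toLinearPMap
    { carrier := {p | ∀ x : A.domain, ⟪A x, p.1⟫_ℂ = ⟪(x : H), p.2⟫_ℂ}
      add_mem' := fun hp hq x => by
        simp only [Prod.fst_add, Prod.snd_add, inner_add_right, hp x, hq x]
      zero_mem' := fun x => by simp
      smul_mem' := fun c p hp x => by
        simp only [Prod.smul_fst, Prod.smul_snd, inner_smul_right, hp x] }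

variable {B : Type*} {H : B → Type*} [∀ b, NormedAddCommGroup (H b)]
  [∀ b, InnerProductSpace ℂ (H b)]

/-- The adjoint of an operator `A` on a module `Γ` of bounded sections of a family of Hilbert
spaces, for the function-valued inner product `⟨ψ|η⟩(b) = ⟨ψ(b)|η(b)⟩`: `ψ ∈ Dom A*` and
`A* ψ = η` iff `⟨A φ|ψ⟩ = ⟨φ|η⟩` for all `φ ∈ Dom A`. -/
def moduleAdjoint {Γ : Submodule ℂ (lp H ⊤)} (A : Γ →ₗ.[ℂ] Γ) : Γ →ₗ.[ℂ] Γ :=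
  Submodule.toLinearPMap
    { carrier := {p | ∀ (φ : A.domain) (b : B),
        ⟪(A φ).1 b, p.1.1 b⟫_ℂ = ⟪φ.1.1 b, p.2.1 b⟫_ℂ}
      add_mem' := fun {p q} hp hq φ b => by
        have h1 := hp φ b
        have h2 := hq φ b
        simp only [Prod.fst_add, Prod.snd_add, Submodule.coe_add, lp.coeFn_add, Pi.add_apply,
          inner_add_right, h1, h2]
      zero_mem' := fun φ b => by simp
      smul_mem' := fun c p hp φ b => by
        have h1 := hp φ b
        simp only [Prod.smul_fst, Prod.smul_snd, Submodule.coe_smul, lp.coeFn_smul,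
          Pi.smul_apply, inner_smul_right, h1] }

/-- An operator `A` on a Hilbert module is regular if it is closed and densely defined, its
adjoint is densely defined, and `1 + A* A` has dense range. -/
structure IsRegular {Γ : Submodule ℂ (lp H ⊤)} (A : Γ →ₗ.[ℂ] Γ) : Prop where
  isClosed : A.IsClosed
  dense_domain : Dense (A.domain : Set Γ)
  dense_adjoint_domain : Dense ((moduleAdjoint A).domain : Set Γ)
  dense_range : Dense {ζ : Γ | ∃ (φ : A.domain) (χ : (moduleAdjoint A).domain),
    (χ : Γ) = A φ ∧ ζ = (φ : Γ) + moduleAdjoint A χ}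

/-- The evaluation map `ev_b`. -/
def ev (Γ : Submodule ℂ (lp H ⊤)) (b : B) : Γ →ₗ[ℂ] H b :=
  (lp.evalₗ H ⊤ b).comp Γ.subtype

end Operators

section Main

variable {m n : ℕ} {M B : Type*}
  [TopologicalSpace M] [ChartedSpace (EuclideanSpace ℝ (Fin m)) M] [IsManifold (𝓡 m) ∞ M]
  [TopologicalSpace B] [ChartedSpace (EuclideanSpace ℝ (Fin n)) B]
  {F : Type*} [NormedAddCommGroup F] [NormedSpace ℂ F] [FiniteDimensional ℂ F]
  {E : M → Type*} [TopologicalSpace (Bundle.TotalSpace F E)]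
  [∀ x, NormedAddCommGroup (E x)] [∀ x, InnerProductSpace ℂ (E x)]
  [FiberBundle F E] [VectorBundle ℂ F E] [VectorBundle ℝ F E] [SmoothHermitian m F E]
  [SecondCountableTopology M] [MeasurableSpace M] [BorelSpace M]
  {π : M → B}

variable (F E) in
/-- The Hilbert `C_0(B)`-module `Γ_0(B, E_•)`: the completion of `Γ_c^∞(M, E)` in the norm
`sup_b ‖φ|_{M_b}‖`, realised as the closure of `Γ_c^∞(M, E)` in the space of bounded families
`(ψ(b))_{b ∈ B}` with `ψ(b) ∈ L²(M_b, E_b)`. -/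
def SectionModule (g : VerticalMetric m n π) : Submodule ℂ (lp (fun b => FibreL2 F E g b) ⊤) :=
  Submodule.topologicalClosure
    { carrier := {ψ | ∃ φ ∈ CompactSections m F E, ∀ b, IsClassOf (ψ b) φ}
      add_mem' := by
        rintro ψ ψ' ⟨φ, hφ, h⟩ ⟨φ', hφ', h'⟩
        exact ⟨φ + φ', add_mem hφ hφ', fun b => (h b).add (h' b)⟩
      zero_mem' := ⟨0, zero_mem _, fun b => IsClassOf.zero⟩
      smul_mem' := by
        rintro c ψ ⟨φ, hφ, h⟩
        exact ⟨c • φ, Submodule.smul_mem _ c hφ, fun b => (h b).smul c⟩ }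

variable (g : VerticalMetric m n π) (D : SmoothSections m F E →ₗ[ℂ] SmoothSections m F E)

/-- The operator `D` on `Γ_0(B, E_•)` with the initial domain `Γ_c^∞(M, E)`. -/
def moduleOperator : SectionModule F E g →ₗ.[ℂ] SectionModule F E g :=
  Submodule.toLinearPMap
    { carrier := {p | ∃ φ ∈ CompactSections m F E,
        ∀ b, IsClassOf (p.1.1 b) φ ∧ IsClassOf (p.2.1 b) (D φ)}
      add_mem' := by
        rintro p q ⟨φ, hφ, h⟩ ⟨φ', hφ', h'⟩
        exact ⟨φ + φ', add_mem hφ hφ', fun b => ⟨(h b).1.add (h' b).1, by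
          rw [map_add]
          exact (h b).2.add (h' b).2⟩⟩
      zero_mem' := ⟨0, zero_mem _, fun b => ⟨IsClassOf.zero, by
        rw [map_zero]
        exact IsClassOf.zero⟩⟩
      smul_mem' := by
        rintro c p ⟨φ, hφ, h⟩
        exact ⟨c • φ, Submodule.smul_mem _ c hφ, fun b => ⟨(h b).1.smul c, by
          rw [map_smul]
          exact (h b).2.smul c⟩⟩ }

/-- The operator `D_b` on `L²(M_b, E_b)` to which `D` restricts, with the initial domain
`Γ_c^∞(M_b, E_b) = {φ|_{M_b} : φ ∈ Γ_c^∞(M, E)}`: `D_b (φ|_{M_b}) = (D φ)|_{M_b}`. -/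
def fibreOperator (b : B) : FibreL2 F E g b →ₗ.[ℂ] FibreL2 F E g b :=
  Submodule.toLinearPMap
    { carrier := {p | ∃ φ ∈ CompactSections m F E, IsClassOf p.1 φ ∧ IsClassOf p.2 (D φ)}
      add_mem' := by
        rintro p q ⟨φ, hφ, h⟩ ⟨φ', hφ', h'⟩
        exact ⟨φ + φ', add_mem hφ hφ', h.1.add h'.1, by
          rw [map_add]
          exact h.2.add h'.2⟩
      zero_mem' := ⟨0, zero_mem _, IsClassOf.zero, by
        rw [map_zero]
        exact IsClassOf.zero⟩
      smul_mem' := by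
        rintro c p ⟨φ, hφ, h⟩
        exact ⟨c • φ, Submodule.smul_mem _ c hφ, h.1.smul c, by
          rw [map_smul]
          exact h.2.smul c⟩ }

end Main

end VerticalOperator

end

open VerticalOperator

noncomputable section

namespace VerticalOperator

/-! ### Adjoints on a single Hilbert space. -/

section HilbertAdjoint

variable {H : Type*} [NormedAddCommGroup H] [InnerProductSpace ℂ H]

/-! The theorem is a local-global principle. For a closed densely defined `A` on a Hilbert module,
let `graphSum A` be the sum of the graph of `A` and the rotated graph {(-A*χ, χ)} of its adjoint.
The two summands are orthogonal in every fibre, so `graphSum A` is always closed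
(`isClosed_graphSum`). If `A*` is densely defined, regularity amounts to `graphSum A = ⊤`
(`graphSum_eq_top_of_isRegular`, `dense_range_of_graphSum_eq_top`).

If the sum is everything and x lies in the domain of `T_b*`, lift (-T_b* x, x) from the fibre to Γ ×
Γ and decompose the lift. Orthogonality in the fibre shows that x is the value at b of the component
in Dom A*, which gives statement 3 (`IsFibrewiseClosure.map_domain_eq`). Statement 3 gives 2 because
`T_b*` is closed. Conversely, a core is enough to make the values of `graphSum A` at b dense in H_b
× H_b (`IsFibrewiseClosure.dense_eval_graphSum`). A partition of unity on the base turns density in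
each fibre into density in the module (`IsSmoothModule.dense_of_dense_eval`), and closedness
finishes the argument.

The geometric half checks that Γ_0(B, E_•) and D satisfy the axioms of this principle. Integration
along the fibres preserves continuity for functions of compact support, by charts that straighten π,
so fibre norms vary continuously. The spaces L²(M_b) are complete, and restrictions of smooth
sections are dense in them. The first-order condition makes D local, symmetry makes it well defined
on fibres and closable, and C^∞(B)-linearity makes its closed graph a module over functions on the
base. -/

/-- `Submodule.toLinearPMap` has the prescribed graph only if the relation is single-valued; for an
adjoint this is the density of the domain. -/
theorem mem_graph_hilbertAdjoint {A : H →ₗ.[ℂ] H} (hA : Dense (A.domain : Set H)) {p : H × H} :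
    p ∈ (hilbertAdjoint A).graph ↔ ∀ x : A.domain, ⟪A x, p.1⟫_ℂ = ⟪(x : H), p.2⟫_ℂ := by
  unfold hilbertAdjoint
  rw [Submodule.toLinearPMap_graph_eq]
  · rfl
  · intro q hq h0
    refine hA.eq_zero_of_inner_right (𝕜 := ℂ) fun v hv => ?_
    have := hq ⟨v, hv⟩
    rw [h0, inner_zero_right] at this
    exact this.symm

theorem isClosed_hilbertAdjoint {A : H →ₗ.[ℂ] H} (hA : Dense (A.domain : Set H)) :
    (hilbertAdjoint A).IsClosed := by
  have : ((hilbertAdjoint A).graph : Set (H × H)) =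
      ⋂ x : A.domain, {p | ⟪A x, p.1⟫_ℂ = ⟪(x : H), p.2⟫_ℂ} := by
    ext p
    simp only [SetLike.mem_coe, mem_graph_hilbertAdjoint hA, Set.mem_iInter, Set.mem_ofPred_eq]
  rw [LinearPMap.IsClosed, this]
  exact isClosed_iInter fun x => isClosed_eq (by fun_prop) (by fun_prop)

end HilbertAdjoint

/-! ### Orthogonal decomposition by the graphs of an operator and its adjoint. -/

section ModuleAdjoint

variable {B : Type*} {H : B → Type*} [∀ b, NormedAddCommGroup (H b)]
  [∀ b, InnerProductSpace ℂ (H b)]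

theorem continuous_ev (Γ : Submodule ℂ (lp H ⊤)) (b : B) : Continuous (ev Γ b) := by
  refine AddMonoidHomClass.continuous_of_bound (ev Γ b) 1 fun ψ => ?_
  rw [one_mul]
  exact lp.norm_apply_le_norm ENNReal.top_ne_zero ψ.1 b

theorem continuous_eval_lp (Γ : Submodule ℂ (lp H ⊤)) (b : B) : Continuous fun ψ : Γ => ψ.1 b :=
  continuous_ev Γ b

/-- The inner product is function-valued, so single-valuedness is checked fibre by fibre; hence
density is required of the values of the domain in every fibre. -/
theorem mem_graph_moduleAdjoint {Γ : Submodule ℂ (lp H ⊤)} {A : Γ →ₗ.[ℂ] Γ}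
    (hA : ∀ b, Dense (A.domain.map (ev Γ b) : Set (H b))) {p : Γ × Γ} :
    p ∈ (moduleAdjoint A).graph ↔ ∀ (φ : A.domain) (b : B),
        ⟪(A φ).1 b, p.1.1 b⟫_ℂ = ⟪φ.1.1 b, p.2.1 b⟫_ℂ := by
  unfold moduleAdjoint
  rw [Submodule.toLinearPMap_graph_eq]
  · rfl
  · intro q hq h0
    ext b
    change q.2.1 b = 0
    refine (hA b).eq_zero_of_inner_right (𝕜 := ℂ) ?_
    rintro _ ⟨φ, hφ, rfl⟩
    have := hq ⟨φ, hφ⟩ b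
    rw [h0] at this
    have h1 : ⟪φ.1 b, q.2.1 b⟫_ℂ = 0 := by simpa using this.symm
    exact h1

theorem isClosed_moduleAdjoint {Γ : Submodule ℂ (lp H ⊤)} {A : Γ →ₗ.[ℂ] Γ}
    (hA : ∀ b, Dense (A.domain.map (ev Γ b) : Set (H b))) : (moduleAdjoint A).IsClosed := by
  have : ((moduleAdjoint A).graph : Set (Γ × Γ)) = ⋂ (φ : A.domain) (b : B),
      {p | ⟪(A φ).1 b, p.1.1 b⟫_ℂ = ⟪φ.1.1 b, p.2.1 b⟫_ℂ} := by
    ext p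
    simp only [SetLike.mem_coe, mem_graph_moduleAdjoint hA, Set.mem_iInter, Set.mem_ofPred_eq]
  rw [LinearPMap.IsClosed, this]
  refine isClosed_iInter fun x => isClosed_iInter fun b => isClosed_eq ?_ ?_
  · exact continuous_const.inner ((continuous_eval_lp Γ b).comp continuous_fst)
  · exact continuous_const.inner ((continuous_eval_lp Γ b).comp continuous_snd)

/-- The sum of the graph of `A` and of the rotated graph `{(-A* χ, χ)}` of its adjoint. -/
def graphSum {Γ : Submodule ℂ (lp H ⊤)} (A : Γ →ₗ.[ℂ] Γ) : Submodule ℂ (Γ × Γ) where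
  carrier := {p | ∃ q ∈ A.graph, ∃ r ∈ (moduleAdjoint A).graph, p = (q.1 - r.2, q.2 + r.1)}
  add_mem' := by
    rintro _ _ ⟨q, hq, r, hr, rfl⟩ ⟨q', hq', r', hr', rfl⟩
    refine ⟨q + q', add_mem hq hq', r + r', add_mem hr hr', ?_⟩
    ext1 <;> simp <;> abel
  zero_mem' := ⟨0, zero_mem _, 0, zero_mem _, by simp; rfl⟩
  smul_mem' := by
    rintro c _ ⟨q, hq, r, hr, rfl⟩
    exact ⟨c • q, Submodule.smul_mem _ _ hq, c • r, Submodule.smul_mem _ _ hr, by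
      ext1 <;> simp [smul_sub, smul_add]⟩

theorem inner_eval_of_mem_graph {Γ : Submodule ℂ (lp H ⊤)} {A : Γ →ₗ.[ℂ] Γ}
    (hA : ∀ b, Dense (A.domain.map (ev Γ b) : Set (H b))) {q r : Γ × Γ}
    (hq : q ∈ A.graph) (hr : r ∈ (moduleAdjoint A).graph) (b : B) :
    ⟪q.2.1 b, r.1.1 b⟫_ℂ = ⟪q.1.1 b, r.2.1 b⟫_ℂ := by
  obtain ⟨φ, h1, h2⟩ := (LinearPMap.mem_graph_iff A).1 hq
  rw [← h1, ← h2]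
  exact (mem_graph_moduleAdjoint hA).1 hr φ b

/-- Pythagoras: by the defining relation of the adjoint, the cross terms of the two squares cancel.
-/
theorem norm_sq_eval_le_of_mem_graph {Γ : Submodule ℂ (lp H ⊤)} {A : Γ →ₗ.[ℂ] Γ}
    (hA : ∀ b, Dense (A.domain.map (ev Γ b) : Set (H b))) {q r : Γ × Γ}
    (hq : q ∈ A.graph) (hr : r ∈ (moduleAdjoint A).graph) (b : B) :
    ‖q.1.1 b‖ ^ 2 + ‖q.2.1 b‖ ^ 2 + ‖r.1.1 b‖ ^ 2 + ‖r.2.1 b‖ ^ 2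
      = ‖q.1.1 b - r.2.1 b‖ ^ 2 + ‖q.2.1 b + r.1.1 b‖ ^ 2 := by
  rw [@norm_sub_sq ℂ, @norm_add_sq ℂ, inner_eval_of_mem_graph hA hq hr b]
  ring

/-- Both graphs are complete, and by orthogonality addition of the two components is bounded below
on their product, so its range is closed. -/
theorem isClosed_graphSum [∀ b, CompleteSpace (H b)] {Γ : Submodule ℂ (lp H ⊤)}
    (hΓ : IsClosed (Γ : Set (lp H ⊤))) {A : Γ →ₗ.[ℂ] Γ} (hAc : A.IsClosed)
    (hA : ∀ b, Dense (A.domain.map (ev Γ b) : Set (H b))) :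
    IsClosed (graphSum A : Set (Γ × Γ)) := by
  have : CompleteSpace Γ := hΓ.completeSpace_coe
  have h1 : CompleteSpace A.graph := hAc.completeSpace_coe
  have h2 : CompleteSpace (moduleAdjoint A).graph :=
    (isClosed_moduleAdjoint hA).completeSpace_coe
  let Φ : (A.graph × (moduleAdjoint A).graph) →ₗ[ℂ] Γ × Γ :=
    { toFun := fun p => (p.1.1.1 - p.2.1.2, p.1.1.2 + p.2.1.1)
      map_add' := fun p q => by ext1 <;> simp <;> abel
      map_smul' := fun c p => by ext1 <;> simp [smul_sub, smul_add] }
  have hΦ : Continuous Φ := by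
    change Continuous fun p : A.graph × (moduleAdjoint A).graph =>
      (p.1.1.1 - p.2.1.2, p.1.1.2 + p.2.1.1)
    fun_prop
  have hrange : (graphSum A : Set (Γ × Γ)) = Set.range Φ := by
    ext p
    constructor
    · rintro ⟨q, hq, r, hr, rfl⟩
      exact ⟨(⟨q, hq⟩, ⟨r, hr⟩), rfl⟩
    · rintro ⟨⟨q, r⟩, rfl⟩
      exact ⟨q.1, q.2, r.1, r.2, rfl⟩
  -- Products carry the maximum norm, so each of the two squares in the fibre identity is at most ‖Φ
  -- p‖². The constant √2 would do; 2 avoids the root.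
  have hanti : AntilipschitzWith 2 Φ := by
    refine AddMonoidHomClass.antilipschitz_of_bound Φ fun p => ?_
    obtain ⟨⟨q, hq⟩, ⟨r, hr⟩⟩ := p
    have hb : ∀ b, ‖q.1.1 b‖ ^ 2 + ‖q.2.1 b‖ ^ 2 + ‖r.1.1 b‖ ^ 2 + ‖r.2.1 b‖ ^ 2
        ≤ (2 * ‖Φ (⟨q, hq⟩, ⟨r, hr⟩)‖) ^ 2 := fun b => by
      rw [norm_sq_eval_le_of_mem_graph hA hq hr b]
      have e1 : ‖q.1.1 b - r.2.1 b‖ ≤ ‖Φ (⟨q, hq⟩, ⟨r, hr⟩)‖ :=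
        (lp.norm_apply_le_norm ENNReal.top_ne_zero (q.1 - r.2).1 b).trans
          (norm_fst_le (Φ (⟨q, hq⟩, ⟨r, hr⟩)))
      have e2 : ‖q.2.1 b + r.1.1 b‖ ≤ ‖Φ (⟨q, hq⟩, ⟨r, hr⟩)‖ :=
        (lp.norm_apply_le_norm ENNReal.top_ne_zero (q.2 + r.1).1 b).trans
          (norm_snd_le (Φ (⟨q, hq⟩, ⟨r, hr⟩)))
      have e3 := pow_le_pow_left₀ (norm_nonneg _) e1 2
      have e4 := pow_le_pow_left₀ (norm_nonneg _) e2 2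
      nlinarith
    have h0 : 0 ≤ 2 * ‖Φ (⟨q, hq⟩, ⟨r, hr⟩)‖ := by positivity
    have key : ∀ ψ : Γ, (∀ b, ‖ψ.1 b‖ ^ 2 ≤ (2 * ‖Φ (⟨q, hq⟩, ⟨r, hr⟩)‖) ^ 2) →
        ‖ψ‖ ≤ 2 * ‖Φ (⟨q, hq⟩, ⟨r, hr⟩)‖ := fun ψ h =>
      lp.norm_le_of_forall_le h0 fun b => (pow_le_pow_iff_left₀ (norm_nonneg _) h0 two_ne_zero).1 (h b)
    refine max_le (max_le (key _ fun b => ?_) (key _ fun b => ?_))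
      (max_le (key _ fun b => ?_) (key _ fun b => ?_)) <;>
    · refine le_trans ?_ (hb b)
      change ‖_‖ ^ 2 ≤ _
      simp only [LinearMap.toAddMonoidHom_coe, Submodule.subtype_apply]
      linarith [sq_nonneg ‖q.1.1 b‖, sq_nonneg ‖q.2.1 b‖, sq_nonneg ‖r.1.1 b‖,
        sq_nonneg ‖r.2.1 b‖]
  rw [hrange]
  exact hanti.isClosed_range (uniformContinuous_addMonoidHom_of_continuous hΦ)

/-- If ζ = φ + A*Aφ, then (ζ, 0) = (φ, Aφ) + (A*Aφ, -Aφ) lies in the sum; by density and closedness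
so does every (ζ, 0). For χ in Dom A* one has (0, χ) = (-A*χ, χ) + (A*χ, 0), and these χ are dense
too. -/
theorem graphSum_eq_top_of_isRegular [∀ b, CompleteSpace (H b)] {Γ : Submodule ℂ (lp H ⊤)}
    (hΓ : IsClosed (Γ : Set (lp H ⊤))) {A : Γ →ₗ.[ℂ] Γ}
    (hA : ∀ b, Dense (A.domain.map (ev Γ b) : Set (H b))) (hreg : IsRegular A) :
    graphSum A = ⊤ := by
  have hcl := isClosed_graphSum hΓ hreg.isClosed hA
  have h1 : ∀ ζ : Γ, (ζ, (0 : Γ)) ∈ graphSum A := by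
    refine fun ζ => hreg.dense_range.induction (P := fun ζ => (ζ, (0 : Γ)) ∈ graphSum A) ?_
      (hcl.preimage (by fun_prop : Continuous fun ζ : Γ => (ζ, (0 : Γ)))) ζ
    rintro _ ⟨φ, χ, hχ, rfl⟩
    refine ⟨(φ, A φ), A.mem_graph φ, (-(χ : Γ), -moduleAdjoint A χ),
      neg_mem ((moduleAdjoint A).mem_graph χ), ?_⟩
    simp [hχ]
  have h2 : ∀ η : Γ, ((0 : Γ), η) ∈ graphSum A := by
    refine fun η => hreg.dense_adjoint_domain.induction (P := fun η => ((0 : Γ), η) ∈ graphSum A) ?_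
      (hcl.preimage (by fun_prop : Continuous fun η : Γ => ((0 : Γ), η))) η
    intro χ hχ
    have : ((-moduleAdjoint A ⟨χ, hχ⟩ : Γ), χ) ∈ graphSum A :=
      ⟨0, zero_mem _, _, (moduleAdjoint A).mem_graph ⟨χ, hχ⟩, by simp⟩
    simpa using add_mem this (h1 (moduleAdjoint A ⟨χ, hχ⟩))
  rw [eq_top_iff]
  rintro ⟨ζ, η⟩ -
  simpa using add_mem (h1 ζ) (h2 η)

/-- Decomposing (ζ, 0) forces the A*-component to be minus the value of A, so ζ itself has the form
φ + A*Aφ: the range is all of Γ. -/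
theorem dense_range_of_graphSum_eq_top {Γ : Submodule ℂ (lp H ⊤)} {A : Γ →ₗ.[ℂ] Γ}
    (h : graphSum A = ⊤) :
    Dense {ζ : Γ | ∃ (φ : A.domain) (χ : (moduleAdjoint A).domain),
      (χ : Γ) = A φ ∧ ζ = (φ : Γ) + moduleAdjoint A χ} := by
  convert dense_univ
  rw [Set.eq_univ_iff_forall]
  intro ζ
  obtain ⟨q, hq, r, hr, h⟩ : (ζ, (0 : Γ)) ∈ graphSum A := h ▸ Submodule.mem_top
  obtain ⟨φ, h1, h2⟩ := (LinearPMap.mem_graph_iff A).1 hq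
  obtain ⟨χ, h3, h4⟩ := (LinearPMap.mem_graph_iff _).1 hr
  obtain ⟨h5, h6⟩ := Prod.ext_iff.1 h
  refine ⟨φ, -χ, ?_, ?_⟩
  · rw [Submodule.coe_neg, h3, h2]
    exact (eq_neg_of_add_eq_zero_left h6.symm).symm
  · rw [LinearPMap.map_neg, h1, h4, ← sub_eq_add_neg]
    exact h5

/-- `T b` is the operator on the fibre `H b` which is the closure of the image of `A`. -/
def IsFibrewiseClosure {Γ : Submodule ℂ (lp H ⊤)} (A : Γ →ₗ.[ℂ] Γ)
    (T : ∀ b, H b →ₗ.[ℂ] H b) : Prop :=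
  ∀ b, ((T b).graph : Set (H b × H b)) =
    closure ((fun p : Γ × Γ => (p.1.1 b, p.2.1 b)) '' (A.graph : Set (Γ × Γ)))

variable {Γ : Submodule ℂ (lp H ⊤)} {A : Γ →ₗ.[ℂ] Γ} {T : ∀ b, H b →ₗ.[ℂ] H b}

theorem IsFibrewiseClosure.eval_mem_graph (hT : IsFibrewiseClosure A T) {p : Γ × Γ}
    (hp : p ∈ A.graph) (b : B) : (p.1.1 b, p.2.1 b) ∈ (T b).graph := by
  rw [← SetLike.mem_coe, hT b]
  exact subset_closure ⟨p, hp, rfl⟩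

theorem IsFibrewiseClosure.dense_domain (hT : IsFibrewiseClosure A T)
    (hA : ∀ b, Dense (A.domain.map (ev Γ b) : Set (H b))) (b : B) :
    Dense ((T b).domain : Set (H b)) := by
  refine (hA b).mono ?_
  rintro _ ⟨φ, hφ, rfl⟩
  exact LinearPMap.mem_domain_of_mem_graph (hT.eval_mem_graph (A.mem_graph ⟨φ, hφ⟩) b)

/-- Taking a closure does not change the adjoint, since the pairing condition is closed. Membership
in the graph of `T_b*` can thus be tested on values of elements of the graph of A. -/
theorem IsFibrewiseClosure.mem_graph_adjoint_iff (hT : IsFibrewiseClosure A T)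
    (hA : ∀ b, Dense (A.domain.map (ev Γ b) : Set (H b))) (b : B) {p : H b × H b} :
    p ∈ (hilbertAdjoint (T b)).graph ↔
      ∀ q ∈ A.graph, ⟪q.2.1 b, p.1⟫_ℂ = ⟪q.1.1 b, p.2⟫_ℂ := by
  rw [mem_graph_hilbertAdjoint (hT.dense_domain hA b)]
  constructor
  · intro h q hq
    obtain ⟨x, h1, h2⟩ := (LinearPMap.mem_graph_iff _).1 (hT.eval_mem_graph hq b)
    have := h x
    rwa [h1, h2] at this
  · intro h x
    have hx : ((x : H b), T b x) ∈ closure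
        ((fun p : Γ × Γ => (p.1.1 b, p.2.1 b)) '' (A.graph : Set (Γ × Γ))) := by
      rw [← hT b]
      exact (T b).mem_graph x
    refine closure_minimal (t := {q : H b × H b | ⟪q.2, p.1⟫_ℂ = ⟪q.1, p.2⟫_ℂ}) ?_ ?_ hx
    · rintro _ ⟨q, hq, rfl⟩
      exact h q hq
    · exact isClosed_eq (by fun_prop) (by fun_prop)

theorem IsFibrewiseClosure.eval_mem_graph_adjoint (hT : IsFibrewiseClosure A T)
    (hA : ∀ b, Dense (A.domain.map (ev Γ b) : Set (H b))) {r : Γ × Γ}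
    (hr : r ∈ (moduleAdjoint A).graph) (b : B) :
    (r.1.1 b, r.2.1 b) ∈ (hilbertAdjoint (T b)).graph :=
  (hT.mem_graph_adjoint_iff hA b).2 fun _ hq => inner_eval_of_mem_graph hA hq hr b

theorem IsFibrewiseClosure.map_le_domain (hT : IsFibrewiseClosure A T)
    (hA : ∀ b, Dense (A.domain.map (ev Γ b) : Set (H b))) (b : B) :
    (moduleAdjoint A).domain.map (ev Γ b) ≤ (hilbertAdjoint (T b)).domain := by
  rintro _ ⟨ψ, hψ, rfl⟩
  exact LinearPMap.mem_domain_of_mem_graph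
    (hT.eval_mem_graph_adjoint hA ((moduleAdjoint A).mem_graph ⟨ψ, hψ⟩) b)

theorem IsFibrewiseClosure.map_domain_eq (hT : IsFibrewiseClosure A T)
    (hA : ∀ b, Dense (A.domain.map (ev Γ b) : Set (H b)))
    (hev : ∀ b, Function.Surjective (ev Γ b)) (h : graphSum A = ⊤) (b : B) :
    (moduleAdjoint A).domain.map (ev Γ b) = (hilbertAdjoint (T b)).domain := by
  refine le_antisymm (hT.map_le_domain hA b) fun x hx => ?_
  -- Since (-T_b* x, x) lies in the rotated graph of `T_b*`, its component in the graph of A ought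
  -- to vanish at b.
  obtain ⟨ζ, hζ⟩ := hev b (-hilbertAdjoint (T b) ⟨x, hx⟩)
  obtain ⟨η, hη⟩ := hev b x
  obtain ⟨q, hq, r, hr, he⟩ : (ζ, η) ∈ graphSum A := h ▸ Submodule.mem_top
  obtain ⟨h1, h2⟩ := Prod.ext_iff.1 he
  dsimp only at h1 h2
  subst h1 h2
  have hx' := sub_mem ((hilbertAdjoint (T b)).mem_graph ⟨x, hx⟩)
    (hT.eval_mem_graph_adjoint hA hr b)
  have e1 : x - r.1.1 b = q.2.1 b := by
    rw [← hη]
    exact add_sub_cancel_right (q.2.1 b) (r.1.1 b)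
  have e2 : hilbertAdjoint (T b) ⟨x, hx⟩ - r.2.1 b = -q.1.1 b := by
    have : -hilbertAdjoint (T b) ⟨x, hx⟩ = q.1.1 b - r.2.1 b := hζ.symm
    have h : hilbertAdjoint (T b) ⟨x, hx⟩ = -(q.1.1 b - r.2.1 b) := by rw [← this, neg_neg]
    rw [h]
    abel
  -- The difference (x - r.1(b), T_b* x - r.2(b)) equals (q.2(b), -q.1(b)). Pairing it with q gives
  -- ‖q.2(b)‖² = -‖q.1(b)‖², so both vanish.
  have h3 := (hT.mem_graph_adjoint_iff hA b).1 hx' q hq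
  dsimp only [Prod.fst_sub, Prod.snd_sub] at h3
  rw [e1, e2, inner_neg_right, inner_self_eq_norm_sq_to_K, inner_self_eq_norm_sq_to_K] at h3
  have h4 : ‖q.2.1 b‖ ^ 2 = -‖q.1.1 b‖ ^ 2 := by exact_mod_cast h3
  have h5 : ‖q.2.1 b‖ = 0 := by
    have := sq_nonneg ‖q.1.1 b‖
    have := sq_nonneg ‖q.2.1 b‖
    exact pow_eq_zero_iff two_ne_zero |>.1 (by linarith)
  rw [norm_eq_zero] at h5
  rw [h5, sub_eq_zero] at e1
  exact ⟨r.1, LinearPMap.mem_domain_of_mem_graph hr, e1.symm⟩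

theorem hasCore_of_eq_domain {H : Type*} [NormedAddCommGroup H] [InnerProductSpace ℂ H]
    {S : H →ₗ.[ℂ] H} (hS : S.IsClosed) {V : Submodule ℂ H} (h : V = S.domain) : S.HasCore V := by
  have h1 : S.domRestrict V = S := by
    refine LinearPMap.eq_of_le_of_domain_eq LinearPMap.domRestrict_le ?_
    rw [LinearPMap.domRestrict_domain, h, inf_idem]
  refine ⟨h.le, ?_⟩
  rw [h1]
  refine LinearPMap.eq_of_eq_graph ?_
  rw [← hS.isClosable.graph_closure_eq_closure_graph]
  exact hS.submodule_topologicalClosure_eq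

/-- A vector (w₁, w₂) orthogonal to the graph of T_b satisfies (w₂, -w₁) ∈ graph T_b*. Orthogonality
to the rotated graph of `T_b*`, known on a core and hence everywhere, then makes (w₁, w₂) orthogonal
to itself. -/
theorem IsFibrewiseClosure.dense_eval_graphSum [∀ b, CompleteSpace (H b)]
    (hT : IsFibrewiseClosure A T)
    (hA : ∀ b, Dense (A.domain.map (ev Γ b) : Set (H b))) (b : B)
    (hcore : (hilbertAdjoint (T b)).HasCore ((moduleAdjoint A).domain.map (ev Γ b))) :
    Dense ((fun p : Γ × Γ => (p.1.1 b, p.2.1 b)) '' (graphSum A : Set (Γ × Γ))) := by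
  -- The orthogonal complement criterion for density needs an inner product on H_b × H_b, hence
  -- `WithLp 2`; the conclusion is transported back along the continuous identification.
  let L : (Γ × Γ) →ₗ[ℂ] WithLp 2 (H b × H b) :=
    (WithLp.linearEquiv 2 ℂ (H b × H b)).symm.toLinearMap ∘ₗ ((ev Γ b).prodMap (ev Γ b))
  have hL : Dense (((graphSum A).map L : Submodule ℂ (WithLp 2 (H b × H b))) :
      Set (WithLp 2 (H b × H b))) := by
    rw [Submodule.dense_iff_topologicalClosure_eq_top, Submodule.topologicalClosure_eq_top_iff,
      Submodule.eq_bot_iff]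
    intro w hw
    rw [Submodule.mem_orthogonal] at hw
    have hw' : ∀ q ∈ A.graph, ∀ r ∈ (moduleAdjoint A).graph,
        ⟪q.1.1 b - r.2.1 b, w.fst⟫_ℂ + ⟪q.2.1 b + r.1.1 b, w.snd⟫_ℂ = 0 := fun q hq r hr =>
      hw _ ⟨(q.1 - r.2, q.2 + r.1), ⟨q, hq, r, hr, rfl⟩, rfl⟩
    have h1 : (w.snd, -w.fst) ∈ (hilbertAdjoint (T b)).graph := by
      rw [hT.mem_graph_adjoint_iff hA b]
      intro q hq
      have := hw' q hq 0 (zero_mem _)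
      have h : ⟪q.1.1 b, w.fst⟫_ℂ + ⟪q.2.1 b, w.snd⟫_ℂ = 0 := by simpa using this
      rw [inner_neg_right]
      exact eq_neg_of_add_eq_zero_right h
    -- Orthogonality is a closed condition and holds on the restriction of `T_b*` to values of Dom
    -- A*; since those values form a core, it passes to the whole graph.
    have h2 : ∀ p ∈ (hilbertAdjoint (T b)).graph, -⟪p.2, w.fst⟫_ℂ + ⟪p.1, w.snd⟫_ℂ = 0 := by
      have hcl : IsClosed {p : H b × H b | -⟪p.2, w.fst⟫_ℂ + ⟪p.1, w.snd⟫_ℂ = 0} :=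
        isClosed_eq (by fun_prop) continuous_const
      have hcl2 : ((hilbertAdjoint (T b)).domRestrict
          ((moduleAdjoint A).domain.map (ev Γ b))).IsClosable :=
        (isClosed_hilbertAdjoint (hT.dense_domain hA b)).isClosable.leIsClosable
          LinearPMap.domRestrict_le
      intro p hp
      rw [← hcore.closure_eq, ← hcl2.graph_closure_eq_closure_graph] at hp
      refine closure_minimal ?_ hcl hp
      rintro ⟨_, _⟩ hx
      obtain ⟨⟨_, ⟨ψ, hψ, rfl⟩, hx2⟩, h3, h4⟩ := (LinearPMap.mem_graph_iff _).1 hx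
      have hr := (moduleAdjoint A).mem_graph ⟨ψ, hψ⟩
      have h5 := LinearPMap.mem_graph_snd_inj _ (LinearPMap.le_graph_of_le
        LinearPMap.domRestrict_le hx) (hT.eval_mem_graph_adjoint hA hr b) h3.symm
      have := hw' 0 (zero_mem _) _ hr
      dsimp only at h3 h5
      rw [← h3, h5]
      have h6 : -⟪(moduleAdjoint A ⟨ψ, hψ⟩).1 b, w.fst⟫_ℂ + ⟪ψ.1 b, w.snd⟫_ℂ = 0 := by
        simpa using this
      exact h6
    have h3 := h2 _ h1
    dsimp only at h3
    rw [inner_neg_left, neg_neg, inner_self_eq_norm_sq_to_K, inner_self_eq_norm_sq_to_K] at h3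
    have h4 : ‖w.fst‖ ^ 2 + ‖w.snd‖ ^ 2 = 0 :=
      Complex.ofReal_eq_zero.1 (by push_cast; exact h3)
    have h5 := sq_nonneg ‖w.fst‖
    have h6 := sq_nonneg ‖w.snd‖
    have h7 : w.fst = 0 := norm_eq_zero.1 (pow_eq_zero_iff two_ne_zero |>.1 (by linarith))
    have h8 : w.snd = 0 := norm_eq_zero.1 (pow_eq_zero_iff two_ne_zero |>.1 (by linarith))
    exact WithLp.ofLp_injective 2 (Prod.ext h7 h8)
  have := (WithLp.prod_continuous_ofLp 2 (H b) (H b))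
  have h9 := (WithLp.ofLp_surjective 2).denseRange.dense_image this hL
  convert h9 using 1
  ext p
  simp only [Set.mem_image, SetLike.mem_coe, Submodule.mem_map, exists_exists_and_eq_and]
  rfl

end ModuleAdjoint

/-! ### Hilbert modules over the base: from fibres to global sections. -/

section SmoothModule

variable {n : ℕ} {B : Type*} [TopologicalSpace B] [ChartedSpace (EuclideanSpace ℝ (Fin n)) B]
  {H : B → Type*} [∀ b, NormedAddCommGroup (H b)] [∀ b, InnerProductSpace ℂ (H b)]

variable (n) in
/-- A Hilbert `C_0(B)`-module of sections of a family of Hilbert spaces over the manifold `B`. -/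
structure IsSmoothModule (Γ : Submodule ℂ (lp H ⊤)) : Prop where
  isClosed : IsClosed (Γ : Set (lp H ⊤))
  exists_smul : ∀ f : B → ℝ, ContMDiff (𝓡 n) 𝓘(ℝ, ℝ) ∞ f → (∀ b, f b ∈ Set.Icc (0 : ℝ) 1) →
    ∀ ψ : Γ, ∃ ψ' : Γ, ∀ b, ψ'.1 b = (f b : ℂ) • ψ.1 b
  continuous_norm : ∀ ψ : Γ, Continuous fun b => ‖ψ.1 b‖
  dense_compact_support : Dense {ψ : Γ | ∃ K : Set B, IsCompact K ∧ ∀ b ∉ K, ψ.1 b = 0}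
  denseRange_ev : ∀ b, DenseRange (ev Γ b)

variable {Γ : Submodule ℂ (lp H ⊤)}

theorem norm_le_of_forall_eval_le {ψ : Γ} {C : ℝ} (hC : 0 ≤ C) (h : ∀ b, ‖ψ.1 b‖ ≤ C) :
    ‖ψ‖ ≤ C :=
  lp.norm_le_of_forall_le hC h

/-- A convexity estimate. The alternative `x = 0` serves points outside the compact support, where
the weights may sum to less than 1. -/
theorem norm_sub_sum_smul_le {V ι : Type*} [Fintype ι] [NormedAddCommGroup V] [NormedSpace ℂ V]
    {x : V} {y : ι → V} {f : ι → ℝ} {ε : ℝ} (hε : 0 ≤ ε) (hf : ∀ i, 0 ≤ f i)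
    (hf1 : ∑ i, f i ≤ 1) (hx : ∑ i, f i = 1 ∨ x = 0) (hy : ∀ i, f i ≠ 0 → ‖x - y i‖ ≤ ε) :
    ‖x - ∑ i, (f i : ℂ) • y i‖ ≤ ε := by
  have h1 : x = ∑ i, (f i : ℂ) • x := by
    rw [← Finset.sum_smul, ← Complex.ofReal_sum]
    rcases hx with h | h
    · rw [h]; simp
    · rw [h]; simp
  have h2 : x - ∑ i, (f i : ℂ) • y i = ∑ i, (f i : ℂ) • (x - y i) := by
    conv_lhs => rw [h1]
    rw [← Finset.sum_sub_distrib]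
    simp only [smul_sub]
  calc ‖x - ∑ i, (f i : ℂ) • y i‖ ≤ ∑ i, ‖(f i : ℂ) • (x - y i)‖ := by
        rw [h2]; exact norm_sum_le _ _
    _ ≤ ∑ i, f i * ε := by
        refine Finset.sum_le_sum fun i _ => ?_
        rw [norm_smul, Complex.norm_real, Real.norm_of_nonneg (hf i)]
        by_cases h : f i = 0
        · simp [h]
        · exact mul_le_mul_of_nonneg_left (hy i h) (hf i)
    _ = (∑ i, f i) * ε := by rw [Finset.sum_mul]
    _ ≤ ε := by nlinarith

variable [T2Space B] [SecondCountableTopology B] [IsManifold (𝓡 n) ∞ B]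

/-- A `C^∞(B)`-submodule is dense if it is dense in each fibre. -/
theorem IsSmoothModule.dense_of_dense_eval (hΓ : IsSmoothModule n Γ) {S : Submodule ℂ (Γ × Γ)}
    (hS : ∀ f : B → ℝ, ContMDiff (𝓡 n) 𝓘(ℝ, ℝ) ∞ f → (∀ b, f b ∈ Set.Icc (0 : ℝ) 1) →
      ∀ p ∈ S, ∃ q ∈ S, ∀ b, q.1.1 b = (f b : ℂ) • p.1.1 b ∧ q.2.1 b = (f b : ℂ) • p.2.1 b)
    (hd : ∀ b, Dense ((fun p : Γ × Γ => (p.1.1 b, p.2.1 b)) '' (S : Set (Γ × Γ)))) :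
    Dense (S : Set (Γ × Γ)) := by
  have : LocallyCompactSpace B := ChartedSpace.locallyCompactSpace (EuclideanSpace ℝ (Fin n)) B
  rw [← dense_closure]
  -- It suffices to approximate pairs of sections with compact support, so that finitely many fibres
  -- will do.
  refine (hΓ.dense_compact_support.prod hΓ.dense_compact_support).mono ?_
  rintro p ⟨⟨K₁, hK₁, h₁⟩, ⟨K₂, hK₂, h₂⟩⟩
  rw [Metric.mem_closure_iff]
  intro ε hε
  have hK : IsCompact (K₁ ∪ K₂) := hK₁.union hK₂
  have hs : ∀ b, ∃ s ∈ S, ‖p.1.1 b - s.1.1 b‖ < ε / 2 ∧ ‖p.2.1 b - s.2.1 b‖ < ε / 2 := fun b => by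
    obtain ⟨_, ⟨s, hs, rfl⟩, h⟩ :=
      (hd b).exists_dist_lt (p.1.1 b, p.2.1 b) (half_pos hε)
    rw [Prod.dist_eq, max_lt_iff, dist_eq_norm, dist_eq_norm] at h
    exact ⟨s, hs, h⟩
  choose s hsS hs using hs
  -- An approximation at b remains one on a neighbourhood of b, because norms of sections are
  -- continuous on the base.
  let U : B → Set B := fun b =>
    {b' | ‖p.1.1 b' - (s b).1.1 b'‖ < ε / 2 ∧ ‖p.2.1 b' - (s b).2.1 b'‖ < ε / 2}
  have hU : ∀ b, IsOpen (U b) := fun b =>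
    (isOpen_lt (hΓ.continuous_norm (p.1 - (s b).1)) continuous_const).inter
      (isOpen_lt (hΓ.continuous_norm (p.2 - (s b).2)) continuous_const)
  obtain ⟨t, ht⟩ := hK.elim_finite_subcover U hU fun b _ => Set.mem_iUnion.2 ⟨b, hs b⟩
  obtain ⟨f, hf⟩ := SmoothPartitionOfUnity.exists_isSubordinate (𝓡 n) hK.isClosed
    (fun i : t => U i) (fun i => hU i) (by simpa [Set.iUnion_subtype] using ht)
  have hsum : ∀ b, ∑ i, f i b ≤ 1 := fun b => by
    rw [← finsum_eq_sum_of_fintype]; exact f.sum_le_one b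
  have hsum1 : ∀ b ∈ K₁ ∪ K₂, ∑ i, f i b = 1 := fun b hb => by
    rw [← finsum_eq_sum_of_fintype]; exact f.sum_eq_one hb
  have hq : ∀ i : t, ∃ q ∈ S, ∀ b, q.1.1 b = (f i b : ℂ) • (s i).1.1 b ∧
      q.2.1 b = (f i b : ℂ) • (s i).2.1 b := fun i =>
    hS (f i) (f i).contMDiff (fun b => ⟨f.nonneg i b, f.le_one i b⟩) _ (hsS i)
  choose q hqS hq using hq
  refine ⟨∑ i, q i, sum_mem fun i _ => hqS i, ?_⟩
  have hfU : ∀ b i, f i b ≠ 0 → b ∈ U i := fun b i hi => hf i (subset_tsupport _ hi)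
  have e1 : ∀ b, (∑ i, q i).1.1 b = ∑ i, (f i b : ℂ) • (s i).1.1 b := fun b => by
    rw [Prod.fst_sum]
    exact (map_sum (ev Γ b) _ _).trans (Finset.sum_congr rfl fun i _ => (hq i b).1)
  have e2 : ∀ b, (∑ i, q i).2.1 b = ∑ i, (f i b : ℂ) • (s i).2.1 b := fun b => by
    rw [Prod.snd_sum]
    exact (map_sum (ev Γ b) _ _).trans (Finset.sum_congr rfl fun i _ => (hq i b).2)
  rw [dist_eq_norm]
  refine lt_of_le_of_lt (max_le ?_ ?_) (half_lt_self hε)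
  · refine norm_le_of_forall_eval_le (half_pos hε).le fun b => ?_
    change ‖p.1.1 b - (∑ i, q i).1.1 b‖ ≤ _
    rw [e1]
    refine norm_sub_sum_smul_le (half_pos hε).le (fun i => f.nonneg i b) (hsum b) ?_
      fun i hi => (hfU b i hi).1.le
    by_cases hb : b ∈ K₁ ∪ K₂
    · exact Or.inl (hsum1 b hb)
    · exact Or.inr (h₁ b fun h => hb (Or.inl h))
  · refine norm_le_of_forall_eval_le (half_pos hε).le fun b => ?_
    change ‖p.2.1 b - (∑ i, q i).2.1 b‖ ≤ _
    rw [e2]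
    refine norm_sub_sum_smul_le (half_pos hε).le (fun i => f.nonneg i b) (hsum b) ?_
      fun i hi => (hfU b i hi).2.le
    by_cases hb : b ∈ K₁ ∪ K₂
    · exact Or.inl (hsum1 b hb)
    · exact Or.inr (h₂ b fun h => hb (Or.inr h))

/-- The range is dense, and a vector of the range always has a preimage of norm at most twice its
own. By completeness of Γ, successive approximation then reaches every vector. -/
theorem IsSmoothModule.surjective_ev [∀ b, CompleteSpace (H b)] (hΓ : IsSmoothModule n Γ) (b : B) :
    Function.Surjective (ev Γ b) := by
  have : LocallyCompactSpace B := ChartedSpace.locallyCompactSpace (EuclideanSpace ℝ (Fin n)) B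
  have : CompleteSpace Γ := hΓ.isClosed.completeSpace_coe
  let T : NormedAddGroupHom Γ (H b) := (ev Γ b).toAddMonoidHom.mkNormedAddGroupHom 1 fun ψ => by
    rw [one_mul]
    exact lp.norm_apply_le_norm ENNReal.top_ne_zero ψ.1 b
  have hT : T.SurjectiveOnWith T.range 2 := by
    rintro _ ⟨ψ, rfl⟩
    by_cases h0 : ψ.1 b = 0
    · refine ⟨0, ?_, by simp⟩
      rw [map_zero]
      exact h0.symm
    have hpos : 0 < ‖ψ.1 b‖ := norm_pos_iff.2 h0
    -- Cutting ψ off where ‖ψ(b')‖ ≥ 2‖ψ(b)‖ keeps its value at b and brings its norm below 2‖ψ(b)‖.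
    obtain ⟨f, hf0, hf1, hf⟩ := exists_contMDiffMap_zero_one_of_isClosed (𝓡 n) (n := ⊤)
      (s := {b' | 2 * ‖ψ.1 b‖ ≤ ‖ψ.1 b'‖}) (t := {b})
      (isClosed_le continuous_const (hΓ.continuous_norm ψ)) isClosed_singleton (by
        rw [Set.disjoint_singleton_right]
        intro h
        have h : 2 * ‖ψ.1 b‖ ≤ ‖ψ.1 b‖ := h
        linarith)
    obtain ⟨ψ', hψ'⟩ := hΓ.exists_smul f f.contMDiff hf ψ
    refine ⟨ψ', ?_, ?_⟩
    · change ψ'.1 b = ψ.1 b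
      rw [hψ', hf1 rfl]
      simp
    · refine norm_le_of_forall_eval_le (by positivity) fun b' => ?_
      rw [hψ', norm_smul, Complex.norm_real, Real.norm_of_nonneg (hf b').1]
      change _ ≤ 2 * ‖ψ.1 b‖
      by_cases h : 2 * ‖ψ.1 b‖ ≤ ‖ψ.1 b'‖
      · rw [hf0 h]
        simp
      · have := (hf b').2
        nlinarith [norm_nonneg (ψ.1 b')]
  intro u
  obtain ⟨ψ, hψ, -⟩ := controlled_closure_of_complete two_pos one_pos hT u (by
    have := hΓ.denseRange_ev b u
    exact this)
  exact ⟨ψ, hψ⟩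

/-- Only the graph of A needs an assumption: in the fibrewise relation defining A*, the factor f(b)
comes out of both sides. -/
theorem IsSmoothModule.graphSum_smul (hΓ : IsSmoothModule n Γ) {A : Γ →ₗ.[ℂ] Γ}
    (hA : ∀ b, Dense (A.domain.map (ev Γ b) : Set (H b)))
    (hsmul : ∀ f : B → ℝ, ContMDiff (𝓡 n) 𝓘(ℝ, ℝ) ∞ f → (∀ b, f b ∈ Set.Icc (0 : ℝ) 1) →
      ∀ p ∈ A.graph, ∃ q ∈ A.graph,
        ∀ b, q.1.1 b = (f b : ℂ) • p.1.1 b ∧ q.2.1 b = (f b : ℂ) • p.2.1 b)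
    (f : B → ℝ) (hf : ContMDiff (𝓡 n) 𝓘(ℝ, ℝ) ∞ f) (hf' : ∀ b, f b ∈ Set.Icc (0 : ℝ) 1)
    (p : Γ × Γ) (hp : p ∈ graphSum A) : ∃ q ∈ graphSum A,
      ∀ b, q.1.1 b = (f b : ℂ) • p.1.1 b ∧ q.2.1 b = (f b : ℂ) • p.2.1 b := by
  obtain ⟨q, hq, r, hr, rfl⟩ := hp
  obtain ⟨q', hq', h1⟩ := hsmul f hf hf' q hq
  obtain ⟨χ, hχ⟩ := hΓ.exists_smul f hf hf' r.1
  obtain ⟨ξ, hξ⟩ := hΓ.exists_smul f hf hf' r.2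
  refine ⟨_, ⟨q', hq', (χ, ξ), ?_, rfl⟩, fun b => ⟨?_, ?_⟩⟩
  · rw [mem_graph_moduleAdjoint hA] at hr ⊢
    intro φ b
    dsimp only
    rw [hχ, hξ, inner_smul_right, inner_smul_right, hr φ b]
  · change q'.1.1 b - ξ.1 b = (f b : ℂ) • (q.1.1 b - r.2.1 b)
    rw [hξ, (h1 b).1, smul_sub]
  · change q'.2.1 b + χ.1 b = (f b : ℂ) • (q.2.1 b + r.1.1 b)
    rw [hχ, (h1 b).2, smul_add]

/-- The local-global principle for regularity. -/
theorem IsSmoothModule.isRegular_tfae [∀ b, CompleteSpace (H b)] (hΓ : IsSmoothModule n Γ)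
    {A : Γ →ₗ.[ℂ] Γ} {T : ∀ b, H b →ₗ.[ℂ] H b} (hT : IsFibrewiseClosure A T)
    (hAc : A.IsClosed) (hA : Dense (A.domain : Set Γ))
    (hA' : Dense ((moduleAdjoint A).domain : Set Γ))
    (hsmul : ∀ f : B → ℝ, ContMDiff (𝓡 n) 𝓘(ℝ, ℝ) ∞ f → (∀ b, f b ∈ Set.Icc (0 : ℝ) 1) →
      ∀ p ∈ A.graph, ∃ q ∈ A.graph,
        ∀ b, q.1.1 b = (f b : ℂ) • p.1.1 b ∧ q.2.1 b = (f b : ℂ) • p.2.1 b) :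
    List.TFAE [IsRegular A,
      ∀ b, (hilbertAdjoint (T b)).HasCore ((moduleAdjoint A).domain.map (ev Γ b)),
      ∀ b, (moduleAdjoint A).domain.map (ev Γ b) = (hilbertAdjoint (T b)).domain] := by
  have hAb : ∀ b, Dense (A.domain.map (ev Γ b) : Set (H b)) := fun b => by
    rw [Submodule.map_coe]
    exact (hΓ.denseRange_ev b).dense_image (continuous_ev Γ b) hA
  tfae_have 1 → 3 := fun h =>
    hT.map_domain_eq hAb hΓ.surjective_ev (graphSum_eq_top_of_isRegular hΓ.isClosed hAb h)
  tfae_have 3 → 2 := fun h b =>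
    hasCore_of_eq_domain (isClosed_hilbertAdjoint (hT.dense_domain hAb b)) (h b)
  tfae_have 2 → 1 := fun h => by
    refine ⟨hAc, hA, hA', dense_range_of_graphSum_eq_top ?_⟩
    have hd := hΓ.dense_of_dense_eval (hΓ.graphSum_smul hAb hsmul)
      fun b => hT.dense_eval_graphSum hAb b (h b)
    rw [← (isClosed_graphSum hΓ.isClosed hAc hAb).submodule_topologicalClosure_eq]
    exact Submodule.dense_iff_topologicalClosure_eq_top.1 hd
  tfae_finish

end SmoothModule

/-! ### The Riemannian measure of a fibre in charts. -/

section FibreCharts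

variable {m n : ℕ} {M B : Type*}
  [TopologicalSpace M] [ChartedSpace (EuclideanSpace ℝ (Fin m)) M] [IsManifold (𝓡 m) ∞ M]
  [TopologicalSpace B] [ChartedSpace (EuclideanSpace ℝ (Fin n)) B]
  {π : M → B} {b : B}

theorem VerticalMetric.eval_of_mem (g : VerticalMetric m n π) {x : M}
    {v w : TangentSpace (𝓡 m) x} (hv : v ∈ VerticalSpace m n π x)
    (hw : w ∈ VerticalSpace m n π x) : g.eval v w = g.inner x ⟨v, hv⟩ ⟨w, hw⟩ :=
  dif_pos ⟨hv, hw⟩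

/-- The Gram matrix of the vectors L J eᵢ is Jᵀ G J, with G the Gram matrix of the L eᵢ. -/
theorem VerticalMetric.det_eval_comp (g : VerticalMetric m n π) {k : ℕ} {x : M}
    (L : EuclideanSpace ℝ (Fin k) →L[ℝ] TangentSpace (𝓡 m) x)
    (hL : ∀ v, L v ∈ VerticalSpace m n π x)
    (J : EuclideanSpace ℝ (Fin k) →L[ℝ] EuclideanSpace ℝ (Fin k)) :
    (Matrix.of fun i j => g.eval (L (J (EuclideanSpace.single i (1 : ℝ))))
      (L (J (EuclideanSpace.single j (1 : ℝ))))).det =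
    J.det ^ 2 * (Matrix.of fun i j => g.eval (L (EuclideanSpace.single i (1 : ℝ)))
      (L (EuclideanSpace.single j (1 : ℝ)))).det := by
  let e := (EuclideanSpace.basisFun (Fin k) ℝ).toBasis
  have he : ∀ i, e i = EuclideanSpace.single i (1 : ℝ) := fun i => by simp [e]
  let L' : EuclideanSpace ℝ (Fin k) →ₗ[ℝ] VerticalSpace m n π x :=
    LinearMap.codRestrict _ L.toLinearMap hL
  let β : LinearMap.BilinForm ℝ (EuclideanSpace ℝ (Fin k)) := (g.inner x).compl₁₂ L' L'
  have h1 : (Matrix.of fun i j => g.eval (L (EuclideanSpace.single i (1 : ℝ)))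
      (L (EuclideanSpace.single j (1 : ℝ)))) = LinearMap.BilinForm.toMatrix e β := by
    ext i j
    rw [LinearMap.BilinForm.toMatrix_apply, Matrix.of_apply, he, he,
      g.eval_of_mem (hL _) (hL _)]
    rfl
  have h2 : (Matrix.of fun i j => g.eval (L (J (EuclideanSpace.single i (1 : ℝ))))
      (L (J (EuclideanSpace.single j (1 : ℝ))))) =
      LinearMap.BilinForm.toMatrix e (β.comp J.toLinearMap J.toLinearMap) := by
    ext i j
    rw [LinearMap.BilinForm.toMatrix_apply, Matrix.of_apply, he, he,
      g.eval_of_mem (hL _) (hL _)]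
    rfl
  rw [h1, h2, LinearMap.BilinForm.toMatrix_comp e e, Matrix.det_mul, Matrix.det_mul,
    Matrix.det_transpose, LinearMap.det_toMatrix, ContinuousLinearMap.det]
  ring

namespace FibreChart

variable (c c' : FibreChart m n π b)

/-- The parametrisation of an open part of the fibre by the coordinates of a fibre chart. -/
def param (y : EuclideanSpace ℝ (Fin (m - n))) : M := (c.toHomeo.symm y : Fibre π b).1

theorem contMDiffAt_param {y : EuclideanSpace ℝ (Fin (m - n))} (hy : y ∈ c.toHomeo.target) :
    ContMDiffAt (𝓡 (m - n)) (𝓡 m) ∞ c.param y :=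
  c.smooth_symm.contMDiffAt (c.toHomeo.open_target.mem_nhds hy)

theorem mdifferentiableAt_param {y : EuclideanSpace ℝ (Fin (m - n))}
    (hy : y ∈ c.toHomeo.target) : MDifferentiableAt (𝓡 (m - n)) (𝓡 m) c.param y :=
  (c.contMDiffAt_param hy).mdifferentiableAt (by simp)

theorem mfderiv_param_mem_verticalSpace (hπ : ContMDiff (𝓡 m) (𝓡 n) ∞ π)
    {y : EuclideanSpace ℝ (Fin (m - n))} (hy : y ∈ c.toHomeo.target)
    (v : EuclideanSpace ℝ (Fin (m - n))) :
    mfderiv (𝓡 (m - n)) (𝓡 m) c.param y v ∈ VerticalSpace m n π (c.param y) := by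
  have h1 : mfderiv (𝓡 (m - n)) (𝓡 n) (π ∘ c.param) y = 0 := by
    have : π ∘ c.param = fun _ => b := funext fun z => (c.toHomeo.symm z).2
    rw [this]
    exact mfderiv_const
  rw [mfderiv_comp y ((hπ _).mdifferentiableAt (by simp)) (c.mdifferentiableAt_param hy)] at h1
  exact DFunLike.congr_fun h1 v

/-- Near the point the transition map is the parametrisation into M followed by the local extension
r of the second chart to M. -/
theorem differentiableAt_transition {y : EuclideanSpace ℝ (Fin (m - n))}
    (hy : y ∈ c.toHomeo.target) (hy' : c.toHomeo.symm y ∈ c'.toHomeo.source) :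
    DifferentiableAt ℝ (c'.toHomeo ∘ c.toHomeo.symm) y := by
  obtain ⟨r, hr, hr'⟩ := c'.smooth _ hy'
  have h1 : MDifferentiableAt (𝓡 (m - n)) (𝓡 (m - n)) (r ∘ c.param) y :=
    MDifferentiableAt.comp y (hr.mdifferentiableAt (by simp)) (c.mdifferentiableAt_param hy)
  refine h1.differentiableAt.congr_of_eventuallyEq ?_
  have h2 := (c.toHomeo.continuousAt_symm hy).preimage_mem_nhds
    (c'.toHomeo.open_source.mem_nhds hy')
  filter_upwards [h2] with z hz
  exact (hr' _ hz).symm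

theorem density_transition (hπ : ContMDiff (𝓡 m) (𝓡 n) ∞ π) (g : VerticalMetric m n π)
    {y : EuclideanSpace ℝ (Fin (m - n))} (hy : y ∈ c.toHomeo.target)
    (hy' : c.toHomeo.symm y ∈ c'.toHomeo.source) :
    g.density c y = |(fderiv ℝ (c'.toHomeo ∘ c.toHomeo.symm) y).det| *
      g.density c' (c'.toHomeo (c.toHomeo.symm y)) := by
  set τ := c'.toHomeo ∘ c.toHomeo.symm with hτ
  have hτd := c.differentiableAt_transition c' hy hy'
  have hy2 : τ y ∈ c'.toHomeo.target := c'.toHomeo.map_source hy'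
  have heq : c.param =ᶠ[nhds y] c'.param ∘ τ := by
    filter_upwards [(c.toHomeo.continuousAt_symm hy).preimage_mem_nhds
      (c'.toHomeo.open_source.mem_nhds hy')] with z hz
    exact congrArg Subtype.val (c'.toHomeo.left_inv hz).symm
  have hpt : c.param y = c'.param (τ y) := heq.self_of_nhds
  have hder : ∀ v : EuclideanSpace ℝ (Fin (m - n)),
      (mfderiv (𝓡 (m - n)) (𝓡 m) c.param y v : EuclideanSpace ℝ (Fin m)) =
        mfderiv (𝓡 (m - n)) (𝓡 m) c'.param (τ y) (fderiv ℝ τ y v) := by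
    intro v
    have h1 := mfderiv_comp (I := 𝓡 (m - n)) (I' := 𝓡 (m - n)) (I'' := 𝓡 m) y
      (c'.mdifferentiableAt_param hy2) hτd.mdifferentiableAt
    have h2 : (mfderiv (𝓡 (m - n)) (𝓡 m) c.param y :
      EuclideanSpace ℝ (Fin (m - n)) →L[ℝ] EuclideanSpace ℝ (Fin m)) =
      mfderiv (𝓡 (m - n)) (𝓡 m) (c'.param ∘ τ) y := heq.mfderiv_eq
    rw [h2, h1, mfderiv_eq_fderiv]
    rfl
  -- The two families of vectors live over base points that are only propositionally equal;
  -- generalising the point allows substitution.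
  have hmat : ∀ (x : M) (hx : x = c'.param (τ y))
      (f : Fin (m - n) → TangentSpace (𝓡 m) x)
      (f' : Fin (m - n) → TangentSpace (𝓡 m) (c'.param (τ y)))
      (_ : ∀ i, (f i : EuclideanSpace ℝ (Fin m)) = f' i),
      (Matrix.of fun i j => g.eval (f i) (f j)) = Matrix.of fun i j => g.eval (f' i) (f' j) := by
    rintro x rfl f f' h
    rw [show f = f' from funext h]
  have h3 := hmat _ hpt (fun i => c.coordVec y i)
    (fun i => mfderiv (𝓡 (m - n)) (𝓡 m) c'.param (τ y)
      (fderiv ℝ τ y (EuclideanSpace.single i (1 : ℝ)))) fun i => hder _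
  have h4 := g.det_eval_comp (mfderiv (𝓡 (m - n)) (𝓡 m) c'.param (τ y))
    (c'.mfderiv_param_mem_verticalSpace hπ hy2) (fderiv ℝ τ y)
  unfold VerticalMetric.density
  rw [← Real.sqrt_sq_eq_abs, ← Real.sqrt_mul (sq_nonneg _)]
  exact congrArg Real.sqrt ((congrArg Matrix.det h3).trans h4)

end FibreChart

variable [MeasurableSpace M] [BorelSpace M]

theorem FibreChart.aemeasurable_symm (c : FibreChart m n π b)
    (ρ : EuclideanSpace ℝ (Fin (m - n)) → ENNReal) :
    AEMeasurable c.toHomeo.symm ((volume.restrict c.toHomeo.target).withDensity ρ) :=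
  (c.toHomeo.continuousOn_symm.aemeasurable c.toHomeo.open_target.measurableSet).mono_ac
    (withDensity_absolutelyContinuous _ _)

theorem VerticalMetric.chartVolume_apply (g : VerticalMetric m n π) (c : FibreChart m n π b)
    {S : Set (Fibre π b)} (hS : MeasurableSet S) :
    g.chartVolume c S = ∫⁻ y in c.toHomeo.symm ⁻¹' S ∩ c.toHomeo.target,
      ENNReal.ofReal (g.density c y) := by
  rw [VerticalMetric.chartVolume, Measure.map_apply_of_aemeasurable (c.aemeasurable_symm _) hS,
    withDensity_apply', Measure.restrict_restrict' c.toHomeo.open_target.measurableSet]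

theorem VerticalMetric.chartVolume_compl_source (g : VerticalMetric m n π)
    (c : FibreChart m n π b) : g.chartVolume c c.toHomeo.sourceᶜ = 0 := by
  rw [g.chartVolume_apply c c.toHomeo.open_source.measurableSet.compl]
  have : c.toHomeo.symm ⁻¹' c.toHomeo.sourceᶜ ∩ c.toHomeo.target = ∅ := by
    ext y
    simp only [Set.mem_inter_iff, Set.mem_preimage, Set.mem_compl_iff, Set.mem_empty_iff_false,
      iff_false, not_and]
    intro h1 h2
    exact h1 (c.toHomeo.map_target h2)
  rw [this]
  simp

/-- The Riemannian volumes in two charts of a fibre agree on the overlap. -/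
theorem VerticalMetric.chartVolume_eq (hπ : ContMDiff (𝓡 m) (𝓡 n) ∞ π)
    (g : VerticalMetric m n π) (c c' : FibreChart m n π b) {S : Set (Fibre π b)}
    (hS : MeasurableSet S) (hc : S ⊆ c.toHomeo.source) (hc' : S ⊆ c'.toHomeo.source) :
    g.chartVolume c S = g.chartVolume c' S := by
  rw [g.chartVolume_apply c hS, g.chartVolume_apply c' hS]
  set T := c.toHomeo.symm ⁻¹' S ∩ c.toHomeo.target
  have hT : MeasurableSet T := by
    have h1 : Continuous fun y : c.toHomeo.target => c.toHomeo.symm y.1 :=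
      continuousOn_iff_continuous_domRestrict.1 c.toHomeo.continuousOn_symm
    have h2 := c.toHomeo.open_target.measurableSet.subtype_image (h1.measurable hS)
    convert h2 using 1
    ext y
    simp [T, and_comm]
  have himg : c'.toHomeo.symm ⁻¹' S ∩ c'.toHomeo.target = (c'.toHomeo ∘ c.toHomeo.symm) '' T := by
    ext y
    constructor
    · rintro ⟨h1, h2⟩
      refine ⟨c.toHomeo (c'.toHomeo.symm y), ⟨?_, c.toHomeo.map_source (hc h1)⟩, ?_⟩
      · rw [Set.mem_preimage, c.toHomeo.left_inv (hc h1)]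
        exact h1
      · rw [Function.comp_apply, c.toHomeo.left_inv (hc h1), c'.toHomeo.right_inv h2]
    · rintro ⟨z, ⟨h1, h2⟩, rfl⟩
      refine ⟨?_, c'.toHomeo.map_source (hc' h1)⟩
      rw [Set.mem_preimage, Function.comp_apply, c'.toHomeo.left_inv (hc' h1)]
      exact h1
  have hinj : Set.InjOn (c'.toHomeo ∘ c.toHomeo.symm) T := fun y hy z hz h =>
    c.toHomeo.symm.injOn hy.2 hz.2 (c'.toHomeo.injOn (hc' hy.1) (hc' hz.1) h)
  rw [himg, lintegral_image_eq_lintegral_abs_det_fderiv_mul volume hT (fun y hy =>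
    (c.differentiableAt_transition c' hy.2 (hc' hy.1)).hasFDerivAt.hasFDerivWithinAt) hinj]
  refine setLIntegral_congr_fun hT fun y hy => ?_
  rw [c.density_transition c' hπ g hy.2 (hc' hy.1), ENNReal.ofReal_mul (abs_nonneg _)]
  rfl

/-- On the domain of a chart, the Riemannian measure of a fibre is given by the chart. -/
theorem VerticalMetric.vol_restrict_source (hπ : ContMDiff (𝓡 m) (𝓡 n) ∞ π) (g : VerticalMetric m n π)
    (c : FibreChart m n π b) :
    (g.vol b).restrict c.toHomeo.source = g.chartVolume c := by
  have hle : ∀ c, g.chartVolume c ≤ g.vol b := fun c => le_iSup (g.chartVolume (b := b)) c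
  have hsub : ∀ (c : FibreChart m n π b) (S : Set (Fibre π b)),
      g.chartVolume c S ≤ g.chartVolume c (S ∩ c.toHomeo.source) := fun c S => by
    refine (measure_mono (Set.inter_union_compl S c.toHomeo.source).ge).trans
      ((measure_union_le _ _).trans ?_)
    rw [measure_mono_null Set.inter_subset_right (g.chartVolume_compl_source c), add_zero]
  have hcs := c.toHomeo.open_source.measurableSet
  -- The right-hand side dominates every chart volume: on the source of c by agreement on overlaps,
  -- off it trivially. So it dominates their supremum, which on the source of c leaves only
  -- `chartVolume c`.
  have hub : g.vol b ≤ g.chartVolume c + (g.vol b).restrict c.toHomeo.sourceᶜ := by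
    refine iSup_le fun c' => Measure.le_iff.2 fun S hS => ?_
    rw [← measure_inter_add_sdiff S hcs, Measure.add_apply, Measure.restrict_apply hS]
    refine add_le_add ?_ (hle c' _)
    refine (hsub c' _).trans ?_
    rw [g.chartVolume_eq hπ c' c ((hS.inter hcs).inter c'.toHomeo.open_source.measurableSet)
      Set.inter_subset_right fun x hx => hx.1.2]
    exact measure_mono fun x hx => hx.1.1
  refine le_antisymm ?_ ?_
  · refine Measure.le_iff.2 fun S hS => ?_
    rw [Measure.restrict_apply hS]
    refine (hub _).trans ?_
    rw [Measure.add_apply, Measure.restrict_apply (hS.inter hcs)]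
    have : S ∩ c.toHomeo.source ∩ c.toHomeo.sourceᶜ = ∅ := by
      rw [Set.inter_assoc, Set.inter_compl_self, Set.inter_empty]
    rw [this, measure_empty, add_zero]
    exact measure_mono Set.inter_subset_left
  · refine Measure.le_iff.2 fun S hS => ?_
    rw [Measure.restrict_apply hS]
    exact (hsub c S).trans (hle c _)

end FibreCharts

/-! ### The submersion theorem and the induced fibre charts. -/

section AdaptedCharts

variable (m n : ℕ) {M B : Type*}
  [TopologicalSpace M] [ChartedSpace (EuclideanSpace ℝ (Fin m)) M] [IsManifold (𝓡 m) ∞ M]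
  [TopologicalSpace B] [ChartedSpace (EuclideanSpace ℝ (Fin n)) B]

/-- A chart of `M` in which the submersion `π` is the projection `(z, w) ↦ w`. -/
structure AdaptedChart (π : M → B) where
  toHomeo : OpenPartialHomeomorph M
    (EuclideanSpace ℝ (Fin (m - n)) × EuclideanSpace ℝ (Fin n))
  base : OpenPartialHomeomorph B (EuclideanSpace ℝ (Fin n))
  smooth : ContMDiffOn (𝓡 m)
    𝓘(ℝ, EuclideanSpace ℝ (Fin (m - n)) × EuclideanSpace ℝ (Fin n)) ∞ toHomeo toHomeo.source
  smooth_symm : ContMDiffOn 𝓘(ℝ, EuclideanSpace ℝ (Fin (m - n)) × EuclideanSpace ℝ (Fin n))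
    (𝓡 m) ∞ toHomeo.symm toHomeo.target
  mapsTo : ∀ x ∈ toHomeo.source, π x ∈ base.source
  snd_eq : ∀ x ∈ toHomeo.source, (toHomeo x).2 = base (π x)

variable {m n} {π : M → B}

/-- P is the orthogonal projection onto ker f', identified with ℝ^(m-n); a vector killed by both P
and f' is zero, and the dimensions match. -/
theorem exists_equiv_prod_of_surjective
    (f' : EuclideanSpace ℝ (Fin m) →L[ℝ] EuclideanSpace ℝ (Fin n))
    (hf' : Function.Surjective f') :
    ∃ (P : EuclideanSpace ℝ (Fin m) →L[ℝ] EuclideanSpace ℝ (Fin (m - n)))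
      (A : EuclideanSpace ℝ (Fin m) ≃L[ℝ]
        EuclideanSpace ℝ (Fin (m - n)) × EuclideanSpace ℝ (Fin n)),
      (A : EuclideanSpace ℝ (Fin m) →L[ℝ] _) = P.prod f' := by
  let K := LinearMap.ker f'.toLinearMap
  -- In particular n ≤ m, so the truncated difference `m - n` is the true one.
  have h1 : Module.finrank ℝ K + n = m := by
    have := f'.toLinearMap.finrank_range_add_finrank_ker
    rw [LinearMap.range_eq_top.2 hf', finrank_top, finrank_euclideanSpace_fin,
      finrank_euclideanSpace_fin] at this
    change n + Module.finrank ℝ K = m at this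
    omega
  let L : K ≃L[ℝ] EuclideanSpace ℝ (Fin (m - n)) := ContinuousLinearEquiv.ofFinrankEq (by
    rw [finrank_euclideanSpace_fin]; omega)
  let P := L.toContinuousLinearMap ∘L K.orthogonalProjectionOnto
  have hinj : Function.Injective (P.prod f') := by
    rw [injective_iff_map_eq_zero]
    intro v hv
    obtain ⟨h2, h3⟩ := Prod.ext_iff.1 hv
    have h4 : K.orthogonalProjectionOnto v = 0 := L.map_eq_zero_iff.1 h2
    have h5 := K.orthogonalProjectionOnto_mem_subspace_eq_self ⟨v, h3⟩
    rw [h4] at h5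
    exact (congrArg Subtype.val h5).symm
  refine ⟨P, (LinearEquiv.ofInjectiveOfFinrankEq (P.prod f').toLinearMap hinj
    (by simp; omega)).toContinuousLinearEquiv, ?_⟩
  ext1 v
  rfl

/-- Complete the coordinate expression f of π by the linear map P and apply the inverse function
theorem to (P, f). -/
theorem IsSurjectiveSubmersion.exists_adaptedChart [IsManifold (𝓡 n) ∞ B]
    (hπ : IsSurjectiveSubmersion m n π) (x₀ : M) :
    ∃ a : AdaptedChart m n π, x₀ ∈ a.toHomeo.source := by
  set e := chartAt (EuclideanSpace ℝ (Fin m)) x₀ with he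
  set ψ := chartAt (EuclideanSpace ℝ (Fin n)) (π x₀) with hψ
  set f : EuclideanSpace ℝ (Fin m) → EuclideanSpace ℝ (Fin n) := ψ ∘ π ∘ e.symm with hf
  set O := e.target ∩ e.symm ⁻¹' (π ⁻¹' ψ.source) with hO
  have hOo : IsOpen O := e.continuousOn_symm.isOpen_inter_preimage e.open_target
    (ψ.open_source.preimage hπ.smooth.continuous)
  have hx₀ : x₀ ∈ e.source := mem_chart_source _ x₀
  have hfO : ContDiffOn ℝ ∞ f O := by
    rw [← contMDiffOn_iff_contDiffOn]
    refine (contMDiffOn_chart (I := 𝓡 n) (x := π x₀)).comp (t := ψ.source)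
      ((hπ.smooth.comp_contMDiffOn (contMDiffOn_chart_symm (x := x₀))).mono Set.inter_subset_left)
      fun u hu => hu.2
  have hu₀ : e x₀ ∈ O := by
    refine ⟨e.map_source hx₀, ?_⟩
    rw [Set.mem_preimage, e.left_inv hx₀]
    exact mem_chart_source _ (π x₀)
  have hf' : Function.Surjective (fderiv ℝ f (e x₀)) := by
    have h1 := hπ.surjective_mfderiv x₀
    rw [((hπ.smooth x₀).mdifferentiableAt (by simp)).mfderiv] at h1
    have h2 : Set.range (𝓡 m) = Set.univ := by simp
    rw [h2, fderivWithin_univ] at h1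
    exact h1
  obtain ⟨P, A, hA⟩ := exists_equiv_prod_of_surjective _ hf'
  set h : EuclideanSpace ℝ (Fin m) →
    EuclideanSpace ℝ (Fin (m - n)) × EuclideanSpace ℝ (Fin n) := fun u => (P u, f u) with hh
  have hhO : ContDiffOn ℝ ∞ h O := P.contDiff.contDiffOn.prodMk hfO
  have hhA : ∀ u ∈ O, ContDiffAt ℝ ∞ h u := fun u hu => hhO.contDiffAt (hOo.mem_nhds hu)
  have hder : HasFDerivAt h (A : EuclideanSpace ℝ (Fin m) →L[ℝ] _) (e x₀) := by
    rw [hA]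
    exact P.hasFDerivAt.prodMk
      ((hfO.contDiffAt (hOo.mem_nhds hu₀)).differentiableAt (by simp)).hasFDerivAt
  let h₀ := (hhA _ hu₀).toOpenPartialHomeomorph h hder (by simp)
  -- The local inverse is known to be smooth only where the derivative is invertible; restricting to
  -- this open set makes it smooth on its whole domain.
  set W := O ∩ fderiv ℝ h ⁻¹' Set.range ((↑) : (EuclideanSpace ℝ (Fin m) ≃L[ℝ]
    EuclideanSpace ℝ (Fin (m - n)) × EuclideanSpace ℝ (Fin n)) → _) with hW
  have hWo : IsOpen W :=
    (hhO.continuousOn_fderiv_of_isOpen hOo (by simp)).isOpen_inter_preimage hOo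
      ContinuousLinearEquiv.isOpen
  let h₁ := h₀.restrOpen W hWo
  have hh₁ : ∀ u, h₁ u = h u := fun u => rfl
  have hsrc : ∀ u ∈ h₁.source, u ∈ W := fun u hu => hu.2
  have hx₁ : e x₀ ∈ h₁.source :=
    ⟨(hhA _ hu₀).mem_toOpenPartialHomeomorph_source hder (by simp), hu₀, A, hder.fderiv.symm⟩
  refine ⟨⟨e.trans h₁, ψ, ?_, ?_, ?_, ?_⟩, hx₀, hx₁⟩
  · refine (contMDiffOn_iff_contDiffOn.2 hhO).comp
      ((contMDiffOn_chart (x := x₀)).mono (fun x hx => hx.1)) fun x hx => (hsrc _ hx.2).1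
  · intro p hp
    have hp1 : p ∈ h₁.target := hp.1
    have hu := h₁.map_target hp1
    obtain ⟨hu1, A', hA'⟩ := hsrc _ hu
    have h2 : ContDiffAt ℝ ∞ h₁.symm p := by
      refine h₁.contDiffAt_symm hp1 (f₀' := A') ?_ (hhA _ hu1)
      rw [hA']
      exact ((hhA _ hu1).differentiableAt (by simp)).hasFDerivAt
    have h3 : ContMDiffAt (𝓡 m) (𝓡 m) ∞ e.symm (h₁.symm p) :=
      contMDiffOn_chart_symm.contMDiffAt (e.open_target.mem_nhds hu1.1)
    exact (h3.comp p h2.contMDiffAt).contMDiffWithinAt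
  · intro x hx
    have : e.symm (e x) ∈ π ⁻¹' ψ.source := (hsrc _ hx.2).1.2
    rw [Set.mem_preimage, e.left_inv hx.1] at this
    exact this
  · intro x hx
    change ψ (π (e.symm (e x))) = ψ (π x)
    rw [e.left_inv hx.1]

namespace AdaptedChart

variable (a : AdaptedChart m n π) {b : B}

theorem symm_mem_fibre (hb : b ∈ a.base.source) {z : EuclideanSpace ℝ (Fin (m - n))}
    (hz : (z, a.base b) ∈ a.toHomeo.target) : π (a.toHomeo.symm (z, a.base b)) = b := by
  have h1 := a.toHomeo.map_target hz
  have h2 := a.snd_eq _ h1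
  rw [a.toHomeo.right_inv hz] at h2
  exact (a.base.injOn hb (a.mapsTo _ h1) h2).symm

theorem eq_prod (x : Fibre π b) (hx : x.1 ∈ a.toHomeo.source) :
    a.toHomeo x.1 = ((a.toHomeo x.1).1, a.base b) := by
  have h := a.snd_eq _ hx
  rw [x.2] at h
  rw [← h]

open Classical in
/-- The chart of the fibre over `b` given by an adapted chart. -/
def fibreChart (hb : b ∈ a.base.source) (x₁ : Fibre π b) : FibreChart m n π b where
  toHomeo :=
    { toFun := fun x => (a.toHomeo x.1).1
      -- The inverse must be total with values in the fibre; the point `x₁` is a default value off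
      -- the target.
      invFun := fun z => if hz : (z, a.base b) ∈ a.toHomeo.target then
        ⟨a.toHomeo.symm (z, a.base b), a.symm_mem_fibre hb hz⟩ else x₁
      source := Subtype.val ⁻¹' a.toHomeo.source
      target := (fun z => (z, a.base b)) ⁻¹' a.toHomeo.target
      map_source' := fun x hx => by
        have h := a.toHomeo.map_source hx
        rw [a.eq_prod x hx] at h
        exact h
      map_target' := fun z hz => by
        rw [Set.mem_preimage] at hz
        rw [dif_pos hz]
        exact a.toHomeo.map_target hz
      left_inv' := fun x hx => by
        have h := a.toHomeo.map_source hx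
        rw [a.eq_prod x hx] at h
        rw [dif_pos h]
        refine Subtype.ext ?_
        dsimp only
        rw [← a.eq_prod x hx]
        exact a.toHomeo.left_inv hx
      right_inv' := fun z hz => by
        rw [Set.mem_preimage] at hz
        rw [dif_pos hz]
        dsimp only
        rw [a.toHomeo.right_inv hz]
      open_source := a.toHomeo.open_source.preimage continuous_subtype_val
      open_target := a.toHomeo.open_target.preimage (by fun_prop)
      continuousOn_toFun := continuous_fst.comp_continuousOn
        (a.toHomeo.continuousOn.comp continuous_subtype_val.continuousOn fun x hx => hx)
      continuousOn_invFun := by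
        rw [Topology.IsEmbedding.subtypeVal.continuousOn_iff]
        refine (a.toHomeo.continuousOn_symm.comp (f := fun z => (z, a.base b))
          (by fun_prop) fun z hz => hz).congr fun z hz => ?_
        have hz : (z, a.base b) ∈ a.toHomeo.target := hz
        simp only [Function.comp_apply]
        rw [dif_pos hz] }
  smooth_symm := by
    refine (a.smooth_symm.comp (f := fun z => (z, a.base b))
      (contDiff_prodMk_left _).contMDiff.contMDiffOn fun z hz => hz).congr fun z hz => ?_
    have hz : (z, a.base b) ∈ a.toHomeo.target := hz
    change Subtype.val (dite _ _ _) = _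
    rw [dif_pos hz]
    rfl
  smooth := fun x hx => ⟨fun y => (a.toHomeo y).1,
    contDiff_fst.contMDiff.contMDiffAt.comp x.1
      (a.smooth.contMDiffAt (a.toHomeo.open_source.mem_nhds hx)), fun y _ => rfl⟩

open Classical in
theorem param_fibreChart (hb : b ∈ a.base.source) (x₁ : Fibre π b)
    {z : EuclideanSpace ℝ (Fin (m - n))} (hz : (z, a.base b) ∈ a.toHomeo.target) :
    (a.fibreChart hb x₁).param z = a.toHomeo.symm (z, a.base b) := by
  change Subtype.val (dite _ _ _) = _
  rw [dif_pos hz]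

end AdaptedChart

end AdaptedCharts

/-! ### Continuity of the Riemannian density across fibres. -/

section Density

variable {m n : ℕ} {M B : Type*}
  [TopologicalSpace M] [ChartedSpace (EuclideanSpace ℝ (Fin m)) M] [IsManifold (𝓡 m) ∞ M]
  [TopologicalSpace B] [ChartedSpace (EuclideanSpace ℝ (Fin n)) B]
  {π : M → B}

theorem VerticalMetric.eval_congr (g : VerticalMetric m n π) {x x' : M} (hx : x = x')
    {v w : TangentSpace (𝓡 m) x} {v' w' : TangentSpace (𝓡 m) x'}
    (hv : (v : EuclideanSpace ℝ (Fin m)) = v') (hw : (w : EuclideanSpace ℝ (Fin m)) = w') :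
    g.eval v w = g.eval v' w' := by
  subst hx
  rw [show v = v' from hv, show w = w' from hw]

namespace AdaptedChart

variable (a : AdaptedChart m n π) {b : B}

theorem mdifferentiable : a.toHomeo.MDifferentiable (𝓡 m)
    𝓘(ℝ, EuclideanSpace ℝ (Fin (m - n)) × EuclideanSpace ℝ (Fin n)) :=
  ⟨a.smooth.mdifferentiableOn (by simp), a.smooth_symm.mdifferentiableOn (by simp)⟩

/-- The coordinate vector field of an adapted chart in a direction along the fibres. -/
def field (v : EuclideanSpace ℝ (Fin (m - n))) (x : M) : TangentSpace (𝓡 m) x :=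
  VectorField.mpullback (𝓡 m) 𝓘(ℝ, EuclideanSpace ℝ (Fin (m - n)) × EuclideanSpace ℝ (Fin n))
    a.toHomeo (fun _ => (v, 0)) x

theorem isInvertible_mfderiv {x : M} (hx : x ∈ a.toHomeo.source) :
    (mfderiv (𝓡 m) 𝓘(ℝ, EuclideanSpace ℝ (Fin (m - n)) × EuclideanSpace ℝ (Fin n))
      a.toHomeo x).IsInvertible :=
  ⟨a.mdifferentiable.mfderiv hx, rfl⟩

theorem contMDiffOn_field (v : EuclideanSpace ℝ (Fin (m - n))) :
    ContMDiffOn (𝓡 m) (𝓡 m).tangent ∞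
      (fun x => (⟨x, a.field v x⟩ : TangentBundle (𝓡 m) M)) a.toHomeo.source := by
  have : IsManifold (𝓡 m) 1 M := IsManifold.of_le (n := ∞) (by simp)
  intro x hx
  refine ContMDiffAt.contMDiffWithinAt ?_
  refine ContMDiffAt.mpullback_vectorField_preimage (n := ∞) ?_
    (a.smooth.contMDiffAt (a.toHomeo.open_source.mem_nhds hx)) (a.isInvertible_mfderiv hx) le_rfl
  exact contMDiffAt_vectorSpace_iff_contDiffAt.2 contDiffAt_const

/-- The coordinate vectors of all the fibre charts are values of one vector field on an open set of
M, so the densities of different fibres become one function on that set. The proof differentiates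
`a.toHomeo ∘ c.param = (·, a.base b)` and inverts the derivative of the chart. -/
theorem mfderiv_param (hb : b ∈ a.base.source) (x₁ : Fibre π b)
    {z : EuclideanSpace ℝ (Fin (m - n))} (hz : (z, a.base b) ∈ a.toHomeo.target)
    (v : EuclideanSpace ℝ (Fin (m - n))) :
    (mfderiv (𝓡 (m - n)) (𝓡 m) (a.fibreChart hb x₁).param z v : EuclideanSpace ℝ (Fin m)) =
      a.field v (a.toHomeo.symm (z, a.base b)) := by
  set c := a.fibreChart hb x₁
  have hx := a.toHomeo.map_target hz
  have hzc : z ∈ c.toHomeo.target := hz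
  have hpar := a.param_fibreChart hb x₁ hz
  have h1 : a.toHomeo ∘ c.param =ᶠ[nhds z] fun z' => (z', a.base b) := by
    filter_upwards [c.toHomeo.open_target.mem_nhds hzc] with z' hz'
    rw [Function.comp_apply, a.param_fibreChart hb x₁ hz', a.toHomeo.right_inv hz']
  have h2 := mfderiv_comp (I := 𝓡 (m - n)) (I' := 𝓡 m)
    (I'' := 𝓘(ℝ, EuclideanSpace ℝ (Fin (m - n)) × EuclideanSpace ℝ (Fin n)))
    (g := a.toHomeo) (f := c.param) z
    (by rw [hpar]; exact a.mdifferentiable.mdifferentiableAt hx)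
    (c.mdifferentiableAt_param hzc)
  rw [h1.mfderiv_eq, mfderiv_eq_fderiv, (hasFDerivAt_prodMk_left z (a.base b)).fderiv] at h2
  have h3 : ∀ x (_ : c.param z = x) (_ : x ∈ a.toHomeo.source),
      (mfderiv (𝓡 (m - n)) (𝓡 m) c.param z v : EuclideanSpace ℝ (Fin m)) = a.field v x := by
    rintro x rfl hx
    have h4 := DFunLike.congr_fun h2 v
    obtain ⟨e, he⟩ := a.isInvertible_mfderiv hx
    have h5 : a.field v (c.param z) = e.symm (v, 0) := by
      change (mfderiv (𝓡 m) 𝓘(ℝ, EuclideanSpace ℝ (Fin (m - n)) × EuclideanSpace ℝ (Fin n))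
        a.toHomeo (c.param z)).inverse (v, 0) = _
      rw [← he, ContinuousLinearMap.inverse_equiv]
      rfl
    rw [h5]
    exact (e.symm_apply_eq.2 (h4.trans (DFunLike.congr_fun he.symm _))).symm
  exact h3 _ hpar hx

theorem field_mem_verticalSpace (hπ : ContMDiff (𝓡 m) (𝓡 n) ∞ π)
    (v : EuclideanSpace ℝ (Fin (m - n))) {x : M} (hx : x ∈ a.toHomeo.source) :
    a.field v x ∈ VerticalSpace m n π x := by
  have hb := a.mapsTo x hx
  have h1 := a.eq_prod (⟨x, rfl⟩ : Fibre π (π x)) hx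
  have hz := a.toHomeo.map_source hx
  dsimp only at h1
  rw [h1] at hz
  have h2 := (a.fibreChart hb ⟨x, rfl⟩).mfderiv_param_mem_verticalSpace hπ (y := (a.toHomeo x).1)
    hz v
  have h3 := a.mfderiv_param hb ⟨x, rfl⟩ hz v
  have h4 := a.param_fibreChart hb ⟨x, rfl⟩ hz
  have h5 : a.toHomeo.symm ((a.toHomeo x).1, a.base (π x)) = x := by
    rw [← h1, a.toHomeo.left_inv hx]
  have key : ∀ (y y' : M) (w : TangentSpace (𝓡 m) y), y = y' → w ∈ VerticalSpace m n π y →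
      y' = x → (w : EuclideanSpace ℝ (Fin m)) = a.field v y' →
      a.field v x ∈ VerticalSpace m n π x := by
    rintro y _ w rfl hw rfl h
    rwa [← show w = a.field v y from h]
  exact key _ _ _ h4 h2 h5 h3

/-- Smoothness of the metric is tested on global vertical fields only, so the coordinate fields are
multiplied by a bump function equal to 1 near the given point. -/
theorem continuousOn_eval_field [T2Space M] (hπ : ContMDiff (𝓡 m) (𝓡 n) ∞ π)
    (g : VerticalMetric m n π) (v w : EuclideanSpace ℝ (Fin (m - n))) :
    ContinuousOn (fun x => g.eval (a.field v x) (a.field w x)) a.toHomeo.source := by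
  intro x₁ hx₁
  refine ContinuousAt.continuousWithinAt ?_
  obtain ⟨χ, hχ, -⟩ := (SmoothBumpFunction.nhds_basis_support (I := 𝓡 m)
    (a.toHomeo.open_source.mem_nhds hx₁)).mem_iff.1 Filter.univ_mem
  have hmem : ∀ v x, (χ x • a.field v x : TangentSpace (𝓡 m) x) ∈ VerticalSpace m n π x := by
    intro v x
    by_cases hx : x ∈ a.toHomeo.source
    · exact Submodule.smul_mem _ _ (a.field_mem_verticalSpace hπ v hx)
    · have : χ x = 0 := by
        by_contra h
        exact hx (hχ (subset_tsupport _ h))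
      rw [this, zero_smul]
      exact zero_mem _
  have hsm : ∀ v, ContMDiff (𝓡 m) (𝓡 m).tangent ∞
      (fun x => (⟨x, χ x • a.field v x⟩ : TangentBundle (𝓡 m) M)) := fun v =>
    ContMDiffOn.smul_section_of_tsupport χ.contMDiff.contMDiffOn a.toHomeo.open_source hχ
      (a.contMDiffOn_field v)
  have h1 := g.smooth (fun x => ⟨_, hmem v x⟩) (fun x => ⟨_, hmem w x⟩) (hsm v) (hsm w)
  refine h1.continuous.continuousAt.congr ?_
  filter_upwards [χ.eventuallyEq_one, a.toHomeo.open_source.mem_nhds hx₁] with x hx hx'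
  rw [g.eval_of_mem (a.field_mem_verticalSpace hπ v hx') (a.field_mem_verticalSpace hπ w hx')]
  have hx : χ x = 1 := hx
  have h2 : ∀ v, (⟨χ x • a.field v x, hmem v x⟩ : VerticalSpace m n π x) =
      ⟨a.field v x, a.field_mem_verticalSpace hπ v hx'⟩ := fun v =>
    Subtype.ext ((congrArg (· • a.field v x) hx).trans (one_smul ℝ _))
  rw [← h2 v, ← h2 w]

/-- The Riemannian density of an adapted chart, as a function on its domain. -/
def density (g : VerticalMetric m n π) (x : M) : ℝ :=
  Real.sqrt (Matrix.of fun i j => g.eval (a.field (EuclideanSpace.single i (1 : ℝ)) x)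
    (a.field (EuclideanSpace.single j (1 : ℝ)) x)).det

theorem density_nonneg (g : VerticalMetric m n π) (x : M) : 0 ≤ a.density g x :=
  Real.sqrt_nonneg _

theorem continuousOn_density [T2Space M] (hπ : ContMDiff (𝓡 m) (𝓡 n) ∞ π)
    (g : VerticalMetric m n π) : ContinuousOn (a.density g) a.toHomeo.source := by
  refine Real.continuous_sqrt.comp_continuousOn
    ((Continuous.matrix_det continuous_id).comp_continuousOn ?_)
  exact continuousOn_pi.2 fun i => continuousOn_pi.2 fun j => a.continuousOn_eval_field hπ g _ _

theorem density_fibreChart (g : VerticalMetric m n π) (hb : b ∈ a.base.source) (x₁ : Fibre π b)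
    {z : EuclideanSpace ℝ (Fin (m - n))} (hz : (z, a.base b) ∈ a.toHomeo.target) :
    g.density (a.fibreChart hb x₁) z = a.density g (a.toHomeo.symm (z, a.base b)) := by
  unfold VerticalMetric.density density
  congr 3
  ext i j
  exact g.eval_congr (a.param_fibreChart hb x₁ hz) (a.mfderiv_param hb x₁ hz _)
    (a.mfderiv_param hb x₁ hz _)

end AdaptedChart

end Density

theorem continuous_of_continuousOn_of_forall_notMem {X Y : Type*} [TopologicalSpace X]
    [TopologicalSpace Y] [Zero Y] {f : X → Y} {U K : Set X} (hU : IsOpen U) (hf : ContinuousOn f U)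
    (hK : IsClosed K) (hKU : K ⊆ U) (h0 : ∀ x ∉ K, f x = 0) : Continuous f := by
  rw [continuous_iff_continuousAt]
  intro x
  by_cases hx : x ∈ K
  · exact hf.continuousAt (hU.mem_nhds (hKU hx))
  · refine continuousAt_const.congr (f := fun _ => (0 : Y)) ?_
    filter_upwards [hK.isOpen_compl.mem_nhds hx] with y hy
    exact (h0 y hy).symm

/-! ### Integration along the fibres. -/

section FibreIntegration

variable {m n : ℕ} {M B : Type*}
  [TopologicalSpace M] [T2Space M] [ChartedSpace (EuclideanSpace ℝ (Fin m)) M]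
  [IsManifold (𝓡 m) ∞ M]
  [TopologicalSpace B] [ChartedSpace (EuclideanSpace ℝ (Fin n)) B]
  [MeasurableSpace M] [BorelSpace M] {π : M → B}

theorem AdaptedChart.lintegral_vol (a : AdaptedChart m n π) (hπ : IsSurjectiveSubmersion m n π)
    (g : VerticalMetric m n π) {b : B} (hb : b ∈ a.base.source) {f : M → ENNReal}
    (hf : Measurable f) (hsupp : ∀ x ∉ a.toHomeo.source, f x = 0) :
    ∫⁻ y : Fibre π b, f y.1 ∂(g.vol b) =
      ∫⁻ z in (fun z => (z, a.base b)) ⁻¹' a.toHomeo.target,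
        ENNReal.ofReal (a.density g (a.toHomeo.symm (z, a.base b))) *
          f (a.toHomeo.symm (z, a.base b)) := by
  obtain ⟨x₁, hx₁⟩ := hπ.surjective b
  set c := a.fibreChart hb ⟨x₁, hx₁⟩
  have hfm : Measurable fun y : Fibre π b => f y.1 := hf.comp measurable_subtype_coe
  have htm : MeasurableSet c.toHomeo.target := c.toHomeo.open_target.measurableSet
  have hdens : ContinuousOn (g.density c) c.toHomeo.target := by
    refine ((a.continuousOn_density hπ.smooth g).comp (f := fun z => a.toHomeo.symm (z, a.base b))
      (a.toHomeo.continuousOn_symm.comp (f := fun z => (z, a.base b)) (by fun_prop)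
        fun z hz => hz) fun z hz => a.toHomeo.map_target hz).congr fun z hz => ?_
    exact a.density_fibreChart g hb _ hz
  calc ∫⁻ y : Fibre π b, f y.1 ∂(g.vol b)
      = ∫⁻ y in c.toHomeo.source, f y.1 ∂(g.vol b) := by
        refine (setLIntegral_eq_of_support_subset fun y hy => ?_).symm
        by_contra h
        exact hy (hsupp y.1 h)
    _ = ∫⁻ y, f y.1 ∂(g.chartVolume c) := by rw [g.vol_restrict_source hπ.smooth c]
    _ = ∫⁻ z, f (c.toHomeo.symm z : Fibre π b).1 ∂((volume.restrict c.toHomeo.target).withDensity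
          fun y => ENNReal.ofReal (g.density c y)) :=
        lintegral_map' hfm.aemeasurable (c.aemeasurable_symm _)
    _ = ∫⁻ z in c.toHomeo.target, ENNReal.ofReal (g.density c z) *
          f (c.toHomeo.symm z : Fibre π b).1 := by
        refine lintegral_withDensity_eq_lintegral_mul₀ ?_ ?_
        · exact (hdens.aemeasurable htm).ennreal_ofReal
        · exact hfm.comp_aemeasurable (c.toHomeo.continuousOn_symm.aemeasurable htm)
    _ = _ := by
        refine setLIntegral_congr_fun htm fun z hz => ?_
        have h1 : (c.toHomeo.symm z : Fibre π b).1 = _ := a.param_fibreChart hb _ hz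
        simp only [h1, a.density_fibreChart g hb _ hz, c]

/-- In the chart this is the integral over z of the function density · f, which extends by zero to a
continuous function F(z, w) of compact support; such an integral is continuous in w. Writing the
result as `ENNReal.ofReal (I b)` records finiteness as well. -/
theorem AdaptedChart.exists_continuous_lintegral [T2Space B] (a : AdaptedChart m n π)
    (hπ : IsSurjectiveSubmersion m n π) (g : VerticalMetric m n π) {f : M → ℝ}
    (hf : Continuous f) (hf0 : ∀ x, 0 ≤ f x) (hfc : HasCompactSupport f)
    (hfa : tsupport f ⊆ a.toHomeo.source) :
    ∃ I : B → ℝ, Continuous I ∧ (∀ b, 0 ≤ I b) ∧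
      ∀ b, ∫⁻ y : Fibre π b, ENNReal.ofReal (f y.1) ∂(g.vol b) = ENNReal.ofReal (I b) := by
  classical
  let F : EuclideanSpace ℝ (Fin (m - n)) × EuclideanSpace ℝ (Fin n) → ℝ := fun p =>
    if p ∈ a.toHomeo.target then a.density g (a.toHomeo.symm p) * f (a.toHomeo.symm p) else 0
  set K := a.toHomeo '' tsupport f with hK
  have hKc : IsCompact K := IsCompact.image_of_continuousOn hfc (a.toHomeo.continuousOn.mono hfa)
  have hKt : K ⊆ a.toHomeo.target := by
    rintro _ ⟨x, hx, rfl⟩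
    exact a.toHomeo.map_source (hfa hx)
  have hF0 : ∀ p ∉ K, F p = 0 := by
    intro p hp
    by_cases hpt : p ∈ a.toHomeo.target
    · have : f (a.toHomeo.symm p) = 0 := by
        by_contra h
        exact hp ⟨_, subset_tsupport f h, a.toHomeo.right_inv hpt⟩
      simp only [F, this, mul_zero, ite_self]
    · simp only [F, if_neg hpt]
  have hFt : ContinuousOn F a.toHomeo.target := by
    refine (((a.continuousOn_density hπ.smooth g).comp a.toHomeo.continuousOn_symm
      fun p hp => a.toHomeo.map_target hp).mul
        (hf.comp_continuousOn a.toHomeo.continuousOn_symm)).congr fun p hp => ?_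
    simp only [F, if_pos hp, Function.comp_apply, Pi.mul_apply]
  have hF : Continuous F :=
    continuous_of_continuousOn_of_forall_notMem a.toHomeo.open_target hFt hKc.isClosed hKt hF0
  have hFnn : ∀ p, 0 ≤ F p := fun p => by
    simp only [F]
    split_ifs
    · exact mul_nonneg (a.density_nonneg g _) (hf0 _)
    · exact le_rfl
  have hs : IsCompact (Prod.fst '' K) := hKc.image continuous_fst
  have hz0 : ∀ w, ∀ z ∉ Prod.fst '' K, F (z, w) = 0 := fun w z hz => hF0 _ fun h => hz ⟨_, h, rfl⟩
  let J : EuclideanSpace ℝ (Fin n) → ℝ := fun w => ∫ z, F (z, w)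
  have hJ : Continuous J := by
    have h1 := continuous_parametric_integral_of_continuous (μ := volume)
      (f := fun (w : EuclideanSpace ℝ (Fin n)) (z : EuclideanSpace ℝ (Fin (m - n))) => F (z, w))
      (hF.comp continuous_swap) hs
    convert h1 using 2 with w
    exact (setIntegral_eq_integral_of_forall_compl_eq_zero (hz0 w)).symm
  have hint : ∀ w, Integrable fun z => F (z, w) := fun w => by
    refine Continuous.integrable_of_hasCompactSupport (by fun_prop) ?_
    exact HasCompactSupport.intro hs (hz0 w)
  -- Extension by zero is continuous because I vanishes off the compact set π(tsupport f), which
  -- lies inside the base chart.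
  refine ⟨fun b => if b ∈ a.base.source then J (a.base b) else 0, ?_, ?_, ?_⟩
  · have hπK : IsCompact (π '' tsupport f) :=
      IsCompact.image hfc hπ.smooth.continuous
    refine continuous_of_continuousOn_of_forall_notMem a.base.open_source
      ((hJ.comp_continuousOn a.base.continuousOn).congr fun b hb => if_pos hb) hπK.isClosed ?_ ?_
    · rintro _ ⟨x, hx, rfl⟩
      exact a.mapsTo x (hfa hx)
    · intro b hb
      split_ifs with hbs
      · refine integral_eq_zero_of_ae (Filter.Eventually.of_forall fun z => hF0 _ ?_)
        rintro ⟨x, hx, hxz⟩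
        refine hb ⟨x, hx, a.base.injOn (a.mapsTo x (hfa hx)) hbs ?_⟩
        rw [← a.snd_eq x (hfa hx), hxz]
      · rfl
  · intro b
    dsimp only
    split_ifs
    · exact integral_nonneg fun z => hFnn _
    · exact le_rfl
  · intro b
    dsimp only
    by_cases hb : b ∈ a.base.source
    · rw [if_pos hb, ofReal_integral_eq_lintegral_ofReal (hint _)
        (Filter.Eventually.of_forall fun z => hFnn _),
        a.lintegral_vol hπ g hb (f := fun x => ENNReal.ofReal (f x))
          hf.measurable.ennreal_ofReal fun x hx => by
            rw [image_eq_zero_of_notMem_tsupport fun h => hx (hfa h), ENNReal.ofReal_zero]]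
      have htm : MeasurableSet ((fun z => (z, a.base b)) ⁻¹' a.toHomeo.target) :=
        (a.toHomeo.open_target.preimage (by fun_prop)).measurableSet
      rw [← lintegral_indicator htm]
      refine lintegral_congr fun z => ?_
      by_cases hz : (z, a.base b) ∈ a.toHomeo.target
      · rw [Set.indicator_of_mem (by exact hz), ← ENNReal.ofReal_mul (a.density_nonneg g _)]
        simp only [F, if_pos hz]
      · rw [Set.indicator_of_notMem (by exact hz)]
        simp only [F, if_neg hz, ENNReal.ofReal_zero]
    · rw [if_neg hb, ENNReal.ofReal_zero]
      refine lintegral_eq_zero_of_ae_eq_zero (Filter.Eventually.of_forall fun y => ?_)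
      have : f y.1 = 0 := image_eq_zero_of_notMem_tsupport fun h => hb (by
        have := a.mapsTo _ (hfa h)
        rwa [y.2] at this)
      simp [this]

/-- The integral of a continuous function with compact support along the fibres is a continuous
function on the base. -/
theorem VerticalMetric.exists_continuous_lintegral [SecondCountableTopology M] [T2Space B]
    [IsManifold (𝓡 n) ∞ B] (g : VerticalMetric m n π) (hπ : IsSurjectiveSubmersion m n π)
    {f : M → ℝ} (hf : Continuous f) (hf0 : ∀ x, 0 ≤ f x) (hfc : HasCompactSupport f) :
    ∃ I : B → ℝ, Continuous I ∧ (∀ b, 0 ≤ I b) ∧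
      ∀ b, ∫⁻ y : Fibre π b, ENNReal.ofReal (f y.1) ∂(g.vol b) = ENNReal.ofReal (I b) := by
  have : LocallyCompactSpace M := ChartedSpace.locallyCompactSpace (EuclideanSpace ℝ (Fin m)) M
  choose a ha using hπ.exists_adaptedChart
  obtain ⟨t, ht⟩ := IsCompact.elim_finite_subcover hfc (fun x => (a x).toHomeo.source)
    (fun x => (a x).toHomeo.open_source) fun x _ => Set.mem_iUnion.2 ⟨x, ha x⟩
  obtain ⟨χ, hχ⟩ := SmoothPartitionOfUnity.exists_isSubordinate (𝓡 m) (isClosed_tsupport f)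
    (fun i : t => (a i).toHomeo.source) (fun i => (a i).toHomeo.open_source)
    (by simpa [Set.iUnion_subtype] using ht)
  have h1 : ∀ i : t, ∃ I : B → ℝ, Continuous I ∧ (∀ b, 0 ≤ I b) ∧
      ∀ b, ∫⁻ y : Fibre π b, ENNReal.ofReal (χ i y.1 * f y.1) ∂(g.vol b) =
        ENNReal.ofReal (I b) := fun i =>
    (a i).exists_continuous_lintegral hπ g (f := fun x => χ i x * f x)
      ((χ i).contMDiff.continuous.mul hf) (fun x => mul_nonneg (χ.nonneg i x) (hf0 x))
      hfc.mul_left ((tsupport_mul_subset_left (f := χ i) (g := f)).trans (hχ i))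
  choose I hI hI0 hIf using h1
  refine ⟨fun b => ∑ i, I i b, continuous_finsetSum _ fun i _ => hI i,
    fun b => Finset.sum_nonneg fun i _ => hI0 i b, fun b => ?_⟩
  rw [ENNReal.ofReal_sum_of_nonneg fun i _ => hI0 i b]
  simp only [← hIf]
  rw [← lintegral_finsetSum]
  · refine lintegral_congr fun y => ?_
    rw [← ENNReal.ofReal_sum_of_nonneg fun i _ => mul_nonneg (χ.nonneg i _) (hf0 _),
      ← Finset.sum_mul]
    by_cases hy : y.1 ∈ tsupport f
    · rw [← finsum_eq_sum_of_fintype, χ.sum_eq_one hy, one_mul]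
    · rw [image_eq_zero_of_notMem_tsupport hy, mul_zero]
  · intro i _
    exact (((χ i).contMDiff.continuous.mul hf).measurable.comp
      measurable_subtype_coe).ennreal_ofReal

end FibreIntegration

/-! ### Completeness of the fibre spaces L²(M_b, E_b). -/

/-- Minkowski's inequality for partial sums, carried to the limit by monotone convergence. -/
theorem eLpNorm_tsum_le {α : Type*} [MeasurableSpace α] {μ : Measure α} {f : ℕ → α → ENNReal}
    (hf : ∀ i, AEMeasurable (f i) μ) :
    eLpNorm (fun x => ∑' i, f i x) 2 μ ≤ ∑' i, eLpNorm (f i) 2 μ := by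
  have h2 : ∀ h : α → ENNReal, eLpNorm h 2 μ = (∫⁻ x, h x ^ (2 : ℝ) ∂μ) ^ (1 / 2 : ℝ) := fun h => by
    rw [eLpNorm_eq_lintegral_rpow_enorm_toReal two_ne_zero ENNReal.ofNat_ne_top]
    simp
  have hS : ∀ n, AEMeasurable (∑ i ∈ Finset.range n, f i) μ := fun n =>
    Finset.aemeasurable_sum _ fun i _ => hf i
  have hmono : ∀ x, Monotone fun n => (∑ i ∈ Finset.range n, f i) x := fun x n k hnk => by
    simp only [Finset.sum_apply]
    exact Finset.sum_le_sum_of_subset (Finset.range_mono hnk)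
  have hsup : ∀ x, ∑' i, f i x = ⨆ n, (∑ i ∈ Finset.range n, f i) x := fun x => by
    simp only [Finset.sum_apply]
    exact ENNReal.tsum_eq_iSup_nat
  have h3 : ∀ x, (∑' i, f i x) ^ (2 : ℝ) = ⨆ n, (∑ i ∈ Finset.range n, f i) x ^ (2 : ℝ) :=
    fun x => by
      rw [hsup]
      exact (ENNReal.orderIsoRpow 2 two_pos).map_iSup _
  rw [h2, one_div, ENNReal.rpow_inv_le_iff two_pos]
  simp only [h3]
  rw [lintegral_iSup' (fun n => (hS n).pow_const 2) (Filter.Eventually.of_forall fun x n k hnk =>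
    ENNReal.rpow_le_rpow (hmono x hnk) zero_le_two)]
  refine iSup_le fun n => ?_
  rw [← ENNReal.rpow_inv_le_iff two_pos, ← one_div, ← h2]
  exact (eLpNorm_sum_le (fun i _ => (hf i).aestronglyMeasurable) one_le_two).trans
    (ENNReal.sum_le_tsum _)

theorem completeSpace_fibre {M : Type*} [TopologicalSpace M] (F : Type*) [NormedAddCommGroup F]
    [NormedSpace ℂ F] [FiniteDimensional ℂ F] {E : M → Type*}
    [TopologicalSpace (Bundle.TotalSpace F E)] [∀ x, NormedAddCommGroup (E x)]
    [∀ x, InnerProductSpace ℂ (E x)] [FiberBundle F E] [VectorBundle ℂ F E] (x : M) :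
    CompleteSpace (E x) := by
  have e := (trivializationAt F E x).continuousLinearEquivAt ℂ x
    (FiberBundle.mem_baseSet_trivializationAt' x)
  have : FiniteDimensional ℂ (E x) := e.symm.toLinearEquiv.finiteDimensional
  exact FiniteDimensional.complete ℂ (E x)

section L2

variable {m n : ℕ} {M B : Type*}
  [TopologicalSpace M] [ChartedSpace (EuclideanSpace ℝ (Fin m)) M] [IsManifold (𝓡 m) ∞ M]
  [TopologicalSpace B] [ChartedSpace (EuclideanSpace ℝ (Fin n)) B]
  {F : Type*} [NormedAddCommGroup F] [NormedSpace ℂ F] [FiniteDimensional ℂ F]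
  {E : M → Type*} [TopologicalSpace (Bundle.TotalSpace F E)]
  [∀ x, NormedAddCommGroup (E x)] [∀ x, InnerProductSpace ℂ (E x)]
  [FiberBundle F E] [VectorBundle ℂ F E] [SmoothHermitian m F E]
  [SecondCountableTopology M] [MeasurableSpace M] [BorelSpace M]
  {π : M → B} {g : VerticalMetric m n π} {b : B}

namespace FibreL2Pre

theorem aestronglyMeasurable_norm (r : FibreL2Pre F E g b) :
    AEStronglyMeasurable (fun y => ‖r.1 y‖) (g.vol b) :=
  r.2.1.aestronglyMeasurable_norm (m := m)

theorem inner_def (r s : FibreL2Pre F E g b) :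
    ⟪r, s⟫_ℂ = ∫ y, ⟪r.1 y, s.1 y⟫_ℂ ∂(g.vol b) := rfl

theorem norm_sq (r : FibreL2Pre F E g b) : ‖r‖ ^ 2 = ∫ y, ‖r.1 y‖ ^ 2 ∂(g.vol b) := by
  rw [← inner_self_eq_norm_sq (𝕜 := ℂ), inner_def, ← integral_re (r.integrable_inner r)]
  simp only [inner_self_eq_norm_sq]

theorem ofReal_norm (r : FibreL2Pre F E g b) :
    ENNReal.ofReal ‖r‖ = eLpNorm (fun y => ‖r.1 y‖) 2 (g.vol b) := by
  rw [r.2.2.eLpNorm_eq_integral_rpow_norm two_ne_zero ENNReal.ofNat_ne_top]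
  congr 1
  simp only [norm_norm, ENNReal.toReal_ofNat, Real.rpow_ofNat]
  rw [← r.norm_sq, ← Real.rpow_natCast, ← Real.rpow_mul (norm_nonneg _)]
  norm_num

end FibreL2Pre

/-- The Riesz–Fischer theorem for sections of a hermitian bundle. -/
instance : CompleteSpace (FibreL2 F E g b) := by
  refine NormedAddCommGroup.completeSpace_of_summable_imp_tendsto fun u hu => ?_
  choose r hr using fun i => SeparationQuotient.surjective_mk (u i)
  have hur : ∀ i, ‖u i‖ = ‖r i‖ := fun i => by rw [← hr i, SeparationQuotient.norm_mk]
  simp only [hur] at hu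
  let f : ℕ → Fibre π b → ENNReal := fun i y => ‖(r i).1 y‖ₑ
  have hfm : ∀ i, AEMeasurable (f i) (g.vol b) := fun i => by
    have := (r i).aestronglyMeasurable_norm.enorm
    simpa only [enorm_norm] using this
  have hfn : ∀ i, eLpNorm (f i) 2 (g.vol b) = ENNReal.ofReal ‖r i‖ := fun i => by
    rw [(r i).ofReal_norm]
    exact eLpNorm_congr_enorm_ae (Filter.Eventually.of_forall fun y => by simp [f])
  have hsum : ∑' i, ENNReal.ofReal ‖r i‖ ≠ ⊤ := hu.tsum_ofReal_ne_top
  have htail : ∀ k, eLpNorm (fun y => ∑' i, f (i + k) y) 2 (g.vol b) ≤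
      ∑' i, ENNReal.ofReal ‖r (i + k)‖ := fun k => by
    simp only [← hfn]
    exact eLpNorm_tsum_le fun i => hfm (i + k)
  -- The sum of pointwise norms has finite L² norm, hence is finite almost everywhere.
  have hfin : ∀ᵐ y ∂(g.vol b), ∑' i, f i y ≠ ⊤ := by
    have h1 : AEMeasurable (fun y => ∑' i, f i y) (g.vol b) := AEMeasurable.tsum hfm
    have h2 : ∫⁻ y, (∑' i, f i y) ^ (2 : ℝ) ∂(g.vol b) ≠ ⊤ := by
      have h3 := (htail 0).trans_lt hsum.lt_top
      rw [eLpNorm_eq_lintegral_rpow_enorm_toReal two_ne_zero ENNReal.ofNat_ne_top] at h3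
      simp only [ENNReal.toReal_ofNat, one_div, add_zero] at h3
      rw [ENNReal.rpow_lt_top_iff_of_pos (by norm_num)] at h3
      exact h3.ne
    filter_upwards [ae_lt_top' (h1.pow_const 2) h2] with y hy
    rw [ENNReal.rpow_lt_top_iff_of_pos two_pos] at hy
    exact hy.ne
  have hsumm : ∀ᵐ y ∂(g.vol b), Summable fun i => (r i).1 y := by
    filter_upwards [hfin] with y hy
    have := completeSpace_fibre F (E := E) y.1
    refine Summable.of_norm ?_
    have h1 := ENNReal.summable_toReal hy
    simpa [f] using h1
  -- The candidate limit is the pointwise sum; on the null set without summability `tsum` takes a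
  -- default value, which does no harm.
  let s : ∀ y : Fibre π b, E y.1 := fun y => ∑' i, (r i).1 y
  have hsm : MeasurableSection F E (g.vol b) s := fun x₀ => by
    refine aestronglyMeasurable_of_tendsto_ae Filter.atTop
      (f := fun (k : ℕ) (y : Fibre π b) => ∑ i ∈ Finset.range k,
        (trivializationAt F E x₀).continuousLinearMapAt ℂ y.1 ((r i).1 y))
      (fun k => Finset.aestronglyMeasurable_fun_sum _ fun i _ => (r i).2.1 x₀) ?_
    filter_upwards [hsumm] with y hy
    exact (((trivializationAt F E x₀).continuousLinearMapAt ℂ y.1).hasSum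
      hy.hasSum).tendsto_sum_nat
  have hle : ∀ k, ∀ᵐ y ∂(g.vol b),
      ‖s y - ∑ i ∈ Finset.range k, (r i).1 y‖ₑ ≤ ∑' i, f (i + k) y := fun k => by
    filter_upwards [hsumm] with y hy
    have := completeSpace_fibre F (E := E) y.1
    have e : s y - ∑ i ∈ Finset.range k, (r i).1 y = ∑' i, (r (i + k)).1 y :=
      sub_eq_of_eq_add' (hy.sum_add_tsum_nat_add k).symm
    rw [e]
    exact enorm_tsum_le_tsum_enorm
  have hs2 : MemLp (fun y => ‖s y‖) 2 (g.vol b) := by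
    refine ⟨hsm.aestronglyMeasurable_norm (m := m), ?_⟩
    refine lt_of_le_of_lt (eLpNorm_mono_enorm_ae ?_) ((htail 0).trans_lt hsum.lt_top)
    filter_upwards [hle 0] with y hy
    simpa using hy
  let S : FibreL2Pre F E g b := ⟨s, hsm, hs2⟩
  refine ⟨SeparationQuotient.mk S, ?_⟩
  rw [tendsto_iff_norm_sub_tendsto_zero]
  have hmk : ∀ k, ∑ i ∈ Finset.range k, u i =
      SeparationQuotient.mk (∑ i ∈ Finset.range k, r i) := fun k => by
    simp only [← hr]
    exact (map_sum (SeparationQuotient.mkAddMonoidHom (M := FibreL2Pre F E g b)) _ _).symm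
  have hval : ∀ k (y : Fibre π b), (∑ i ∈ Finset.range k, r i : FibreL2Pre F E g b).1 y =
      ∑ i ∈ Finset.range k, (r i).1 y := fun k y => by
    let L : FibreL2Pre F E g b →+ E y.1 :=
      { toFun := fun t => t.1 y, map_zero' := rfl, map_add' := fun _ _ => rfl }
    exact map_sum L _ _
  have hbd : ∀ k, ENNReal.ofReal ‖∑ i ∈ Finset.range k, u i - SeparationQuotient.mk S‖ ≤
      ∑' i, ENNReal.ofReal ‖r (i + k)‖ := fun k => by
    rw [hmk, norm_sub_rev, ← SeparationQuotient.mk_sub, SeparationQuotient.norm_mk,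
      FibreL2Pre.ofReal_norm]
    refine le_trans (eLpNorm_mono_enorm_ae ?_) (htail k)
    filter_upwards [hle k] with y hy
    rw [← hval] at hy
    simp only [enorm_norm, enorm_eq_self]
    exact hy
  have h0 := ENNReal.tendsto_sum_nat_add (fun i => ENNReal.ofReal ‖r i‖) hsum
  have h1 := tendsto_of_tendsto_of_tendsto_of_le_of_le tendsto_const_nhds h0
    (fun k => zero_le) hbd
  have h2 := (ENNReal.tendsto_toReal ENNReal.zero_ne_top).comp h1
  simpa [Function.comp_def] using h2

end L2

/-! ### Smooth sections: locality, measurability and fibre norms. -/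

section SmoothSections

variable {m n : ℕ} {M B : Type*}
  [TopologicalSpace M] [ChartedSpace (EuclideanSpace ℝ (Fin m)) M] [IsManifold (𝓡 m) ∞ M]
  [TopologicalSpace B] [ChartedSpace (EuclideanSpace ℝ (Fin n)) B]
  {F : Type*} [NormedAddCommGroup F] [NormedSpace ℂ F]
  {E : M → Type*} [TopologicalSpace (Bundle.TotalSpace F E)]
  [∀ x, NormedAddCommGroup (E x)] [∀ x, InnerProductSpace ℂ (E x)]
  [FiberBundle F E] [VectorBundle ℂ F E] [VectorBundle ℝ F E]

namespace SmoothSections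

theorem ext_apply {s t : SmoothSections m F E} (h : ∀ x, s.1 x = t.1 x) : s = t :=
  Subtype.ext (funext h)

theorem continuousOn_coord (s : SmoothSections m F E) (x₀ : M) :
    ContinuousOn (fun y => (trivializationAt F E x₀).continuousLinearMapAt ℂ y (s.1 y))
      (trivializationAt F E x₀).baseSet := by
  set e := trivializationAt F E x₀
  have h1 : Continuous fun x => Bundle.TotalSpace.mk' F x (s.1 x) := ContMDiff.continuous s.2
  have h2 : ContinuousOn (fun y => (e (Bundle.TotalSpace.mk' F y (s.1 y))).2) e.baseSet :=
    continuous_snd.comp_continuousOn (e.continuousOn.comp h1.continuousOn fun y hy =>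
      e.mem_source.2 hy)
  refine h2.congr fun y hy => ?_
  change e.linearMapAt ℂ y (s.1 y) = _
  rw [e.coe_linearMapAt_of_mem hy]

/-- In a local trivialisation the inner product is a sesquilinear expression in continuous
coordinates, whose coefficients are the smooth Gram matrix of a constant basis. -/
theorem continuous_inner [FiniteDimensional ℂ F] [SmoothHermitian m F E]
    (s t : SmoothSections m F E) : Continuous fun x => ⟪s.1 x, t.1 x⟫_ℂ := by
  rw [continuous_iff_continuousAt]
  intro x₀
  let e := trivializationAt F E x₀
  let bF := Module.finBasis ℂ F
  have hx₀ : e.baseSet ∈ nhds x₀ :=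
    e.open_baseSet.mem_nhds (FiberBundle.mem_baseSet_trivializationAt' x₀)
  have hcoord : ∀ (r : SmoothSections m F E) i, ContinuousAt
      (fun y => bF.repr (e.continuousLinearMapAt ℂ y (r.1 y)) i) x₀ := fun r i =>
    (bF.coord i).continuous_of_finiteDimensional.continuousAt.comp
      ((SmoothSections.continuousOn_coord r x₀).continuousAt hx₀)
  have hG : ∀ i j, ContinuousAt (fun y => ⟪e.symmL ℂ y (bF i), e.symmL ℂ y (bF j)⟫_ℂ) x₀ :=
    fun i j => (SmoothHermitian.smooth (m := m) x₀ (bF i) (bF j)).continuousOn.continuousAt hx₀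
  have hsum : ContinuousAt (fun y => ∑ i, ∑ j,
      (starRingEnd ℂ) (bF.repr (e.continuousLinearMapAt ℂ y (s.1 y)) i) *
        (bF.repr (e.continuousLinearMapAt ℂ y (t.1 y)) j *
          ⟪e.symmL ℂ y (bF i), e.symmL ℂ y (bF j)⟫_ℂ)) x₀ :=
    tendsto_finsetSum _ fun i _ => tendsto_finsetSum _ fun j _ =>
      (Complex.continuous_conj.continuousAt.comp (hcoord s i)).mul ((hcoord t j).mul (hG i j))
  refine hsum.congr ?_
  filter_upwards [hx₀] with y hy
  have key : ∀ v : E y, v = ∑ i, bF.repr (e.continuousLinearMapAt ℂ y v) i •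
      e.symmL ℂ y (bF i) := fun v => by
    conv_lhs => rw [← e.symmL_continuousLinearMapAt (R := ℂ) hy v,
      ← bF.sum_repr (e.continuousLinearMapAt ℂ y v)]
    simp only [map_sum, map_smul]
  conv_rhs => rw [key (s.1 y), key (t.1 y)]
  simp only [sum_inner, inner_sum, inner_smul_left, inner_smul_right, Finset.mul_sum]
  rw [Finset.sum_comm]
  exact Finset.sum_congr rfl fun i _ => Finset.sum_congr rfl fun j _ => by ring

theorem continuous_norm_sq [FiniteDimensional ℂ F] [SmoothHermitian m F E]
    (s : SmoothSections m F E) : Continuous fun x => ‖s.1 x‖ ^ 2 := by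
  have h := Complex.continuous_re.comp (SmoothSections.continuous_inner s s)
  refine h.congr fun x => ?_
  exact inner_self_eq_norm_sq (𝕜 := ℂ) (s.1 x)

end SmoothSections

theorem hasCompactSupport_norm_sq [T2Space M] {s : SmoothSections m F E} (hs : s ∈ CompactSections m F E) :
    HasCompactSupport fun x => ‖s.1 x‖ ^ 2 := by
  have h : IsCompact (closure {x | s.1 x ≠ 0}) := hs
  refine HasCompactSupport.intro h fun x hx => ?_
  have : s.1 x = 0 := by
    by_contra h0
    exact hx (subset_closure h0)
  rw [this, norm_zero, zero_pow two_ne_zero]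

theorem fmul_apply (f : M → ℝ) (hf : ContMDiff (𝓡 m) 𝓘(ℝ, ℝ) ∞ f) (s : SmoothSections m F E)
    (x : M) : (fmul f hf s).1 x = (f x : ℂ) • s.1 x := rfl

theorem fmul_mem_compactSections (f : M → ℝ) (hf : ContMDiff (𝓡 m) 𝓘(ℝ, ℝ) ∞ f)
    {s : SmoothSections m F E} (hs : s ∈ CompactSections m F E) :
    fmul f hf s ∈ CompactSections m F E := by
  have h : IsCompact (closure {x | s.1 x ≠ 0}) := hs
  refine h.of_isClosed_subset isClosed_closure (closure_mono fun x hx h0 => hx ?_)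
  rw [fmul_apply, h0, smul_zero]

/-- Take f with f(x) = 0 and f = 1 on the support, so that f s = s. The relation [D, f](f s) = f [D,
f] s then reads D s - f D s = f [D, f] s, and at x it gives (D s)(x) = 0. -/
theorem IsFirstOrder.apply_eq_zero [T2Space M] [SecondCountableTopology M]
    {D : SmoothSections m F E →ₗ[ℂ] SmoothSections m F E} (hD : IsFirstOrder D)
    (s : SmoothSections m F E) {x : M} (hx : x ∉ closure {x | s.1 x ≠ 0}) : (D s).1 x = 0 := by
  have : LocallyCompactSpace M := ChartedSpace.locallyCompactSpace (EuclideanSpace ℝ (Fin m)) M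
  obtain ⟨f, hf0, hf1, -⟩ := exists_contMDiffMap_zero_one_of_isClosed (𝓡 m) (n := ⊤)
    (isClosed_singleton (x := x)) (isClosed_closure (s := {x | s.1 x ≠ 0}))
    (Set.disjoint_singleton_left.2 hx)
  have hfs : fmul f f.contMDiff s = s := SmoothSections.ext_apply fun y => by
    rw [fmul_apply]
    by_cases hy : s.1 y = 0
    · rw [hy, smul_zero]
    · rw [hf1 (subset_closure hy)]
      simp
  have h := hD f f.contMDiff f f.contMDiff s
  unfold commutator at h
  rw [hfs, hfs] at h
  have h2 := congrArg (fun t : SmoothSections m F E => t.1 x) h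
  have h3 : f x = 0 := hf0 rfl
  change (D s).1 x - (f x : ℂ) • (D s).1 x = (f x : ℂ) • _ at h2
  simpa [h3] using h2

theorem IsFirstOrder.map_compactSections [T2Space M] [SecondCountableTopology M]
    {D : SmoothSections m F E →ₗ[ℂ] SmoothSections m F E} (hD : IsFirstOrder D)
    {s : SmoothSections m F E} (hs : s ∈ CompactSections m F E) : D s ∈ CompactSections m F E := by
  have h : IsCompact (closure {x | s.1 x ≠ 0}) := hs
  refine h.of_isClosed_subset isClosed_closure (closure_minimal (fun x hx => ?_) isClosed_closure)
  by_contra h0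
  exact hx (hD.apply_eq_zero s h0)

variable [FiniteDimensional ℂ F] [SmoothHermitian m F E]
  [SecondCountableTopology M] [MeasurableSpace M] [BorelSpace M]
  {π : M → B} {g : VerticalMetric m n π} {b : B}

theorem SmoothSections.measurableSection (s : SmoothSections m F E) :
    MeasurableSection F E (g.vol b) fun y => s.1 y.1 := by
  intro x₀
  have : SecondCountableTopology F := inferInstance
  set e := trivializationAt F E x₀
  have hU : MeasurableSet (Subtype.val ⁻¹' e.baseSet : Set (Fibre π b)) :=
    (e.open_baseSet.preimage continuous_subtype_val).measurableSet
  have h1 : ContinuousOn (fun y : Fibre π b => e.continuousLinearMapAt ℂ y.1 (s.1 y.1))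
      (Subtype.val ⁻¹' e.baseSet) :=
    (SmoothSections.continuousOn_coord s x₀).comp continuous_subtype_val.continuousOn fun y hy => hy
  -- Off the base set `continuousLinearMapAt` is zero, so the coordinate function is an indicator of
  -- its restriction.
  have h2 := (aestronglyMeasurable_indicator_iff hU).2
    (h1.aestronglyMeasurable (μ := g.vol b) hU)
  refine h2.congr (Filter.Eventually.of_forall fun y => ?_)
  by_cases hy : y ∈ (Subtype.val ⁻¹' e.baseSet : Set (Fibre π b))
  · rw [Set.indicator_of_mem hy]
  · rw [Set.indicator_of_notMem hy]
    change _ = e.linearMapAt ℂ y.1 (s.1 y.1)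
    rw [e.linearMapAt_def_of_notMem hy]
    rfl

theorem IsClassOf.unique {u v : FibreL2 F E g b} {s : SmoothSections m F E}
    (hu : IsClassOf u s) (hv : IsClassOf v s) : u = v := by
  obtain ⟨r, hr, rfl⟩ := hu
  obtain ⟨t, ht, rfl⟩ := hv
  congr 1
  exact Subtype.ext (funext fun y => (hr y).trans (ht y).symm)

theorem IsClassOf.inner_eq {u v : FibreL2 F E g b} {s t : SmoothSections m F E}
    (hu : IsClassOf u s) (hv : IsClassOf v t) :
    ⟪u, v⟫_ℂ = ∫ y : Fibre π b, ⟪s.1 y.1, t.1 y.1⟫_ℂ ∂(g.vol b) := by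
  obtain ⟨p, hp, rfl⟩ := hu
  obtain ⟨q, hq, rfl⟩ := hv
  rw [SeparationQuotient.inner_mk_mk, FibreL2Pre.inner_def]
  simp only [hp, hq]

theorem IsClassOf.fmul {u : FibreL2 F E g b} {s : SmoothSections m F E} (hu : IsClassOf u s)
    {f : B → ℝ} (hf : ContMDiff (𝓡 m) 𝓘(ℝ, ℝ) ∞ (f ∘ π)) :
    IsClassOf ((f b : ℂ) • u) (fmul (f ∘ π) hf s) := by
  obtain ⟨p, hp, rfl⟩ := hu
  refine ⟨(f b : ℂ) • p, fun y => ?_, rfl⟩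
  rw [fmul_apply, Function.comp_apply, y.2, ← hp y]
  rfl

variable [T2Space M] [T2Space B] [IsManifold (𝓡 n) ∞ B]

theorem SmoothSections.memLp (hπ : IsSurjectiveSubmersion m n π) {s : SmoothSections m F E}
    (hs : s ∈ CompactSections m F E) (b : B) :
    MemLp (fun y : Fibre π b => ‖s.1 y.1‖) 2 (g.vol b) := by
  rw [memLp_two_iff_integrable_sq ((SmoothSections.measurableSection s).aestronglyMeasurable_norm (m := m))]
  obtain ⟨I, -, -, hI⟩ := g.exists_continuous_lintegral hπ (SmoothSections.continuous_norm_sq s)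
    (fun x => sq_nonneg _) (hasCompactSupport_norm_sq hs)
  refine ⟨((SmoothSections.continuous_norm_sq s).comp continuous_subtype_val).aestronglyMeasurable, ?_⟩
  rw [hasFiniteIntegral_iff_ofReal (Filter.Eventually.of_forall fun y => sq_nonneg _), hI b]
  exact ENNReal.ofReal_lt_top

/-- The restriction of a smooth section with compact support to a fibre. -/
theorem exists_isClassOf (hπ : IsSurjectiveSubmersion m n π) {s : SmoothSections m F E}
    (hs : s ∈ CompactSections m F E) (b : B) : ∃ u : FibreL2 F E g b, IsClassOf u s :=
  ⟨SeparationQuotient.mk ⟨fun y => s.1 y.1, (SmoothSections.measurableSection s), SmoothSections.memLp hπ hs b⟩,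
    _, fun _ => rfl, rfl⟩

/-- The norm of the restrictions to the fibres of a smooth section with compact support is
continuous on the base and vanishes outside a compact set. -/
theorem exists_continuous_norm (hπ : IsSurjectiveSubmersion m n π) {s : SmoothSections m F E}
    (hs : s ∈ CompactSections m F E) : ∃ N : B → ℝ, Continuous N ∧
      (∀ (b : B) (u : FibreL2 F E g b), IsClassOf u s → ‖u‖ = N b) ∧ HasCompactSupport N := by
  obtain ⟨I, hIc, hI0, hI⟩ := g.exists_continuous_lintegral hπ (SmoothSections.continuous_norm_sq s)
    (fun x => sq_nonneg _) (hasCompactSupport_norm_sq hs)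
  refine ⟨fun b => Real.sqrt (I b), Real.continuous_sqrt.comp hIc, ?_, ?_⟩
  · rintro b _ ⟨r, hr, rfl⟩
    have h1 : ‖r‖ ^ 2 = I b := by
      rw [r.norm_sq, integral_eq_lintegral_of_nonneg_ae
        (Filter.Eventually.of_forall fun y => sq_nonneg _) (r.aestronglyMeasurable_norm.pow 2)]
      simp only [hr]
      rw [hI b, ENNReal.toReal_ofReal (hI0 b)]
    dsimp only
    rw [SeparationQuotient.norm_mk, ← h1, Real.sqrt_sq (norm_nonneg _)]
  · have hK : IsCompact (π '' closure {x | s.1 x ≠ 0}) :=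
      IsCompact.image hs hπ.smooth.continuous
    refine HasCompactSupport.intro hK fun b hb => ?_
    have h0 : ∀ y : Fibre π b, s.1 y.1 = 0 := fun y => by
      by_contra h
      exact hb ⟨y.1, subset_closure h, y.2⟩
    have h1 := hI b
    simp only [h0, norm_zero, ne_eq, OfNat.ofNat_ne_zero, not_false_eq_true, zero_pow,
      ENNReal.ofReal_zero, lintegral_zero] at h1
    rw [Real.sqrt_eq_zero (hI0 b)]
    exact le_antisymm (ENNReal.ofReal_eq_zero.1 h1.symm) (hI0 b)

end SmoothSections

/-! ### Density of smooth sections in L²(M_b, E_b). -/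

section Density

variable {m n : ℕ} {M B : Type*}
  [TopologicalSpace M] [ChartedSpace (EuclideanSpace ℝ (Fin m)) M] [IsManifold (𝓡 m) ∞ M]
  [TopologicalSpace B] [ChartedSpace (EuclideanSpace ℝ (Fin n)) B]
  {F : Type*} [NormedAddCommGroup F] [NormedSpace ℂ F]
  {E : M → Type*} [TopologicalSpace (Bundle.TotalSpace F E)]
  [∀ x, NormedAddCommGroup (E x)] [∀ x, InnerProductSpace ℂ (E x)]
  [FiberBundle F E] [VectorBundle ℂ F E] [VectorBundle ℝ F E]
  [ContMDiffVectorBundle ∞ F E (𝓡 m)]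

/-- The smooth section `χ v` obtained from a constant vector in a local trivialisation and a
cutoff function. -/
theorem exists_section_cutoff (x₀ : M) (v : F) {χ : M → ℝ} (hχ : ContMDiff (𝓡 m) 𝓘(ℝ, ℝ) ∞ χ)
    (hc : HasCompactSupport χ) (hs : tsupport χ ⊆ (trivializationAt F E x₀).baseSet) :
    ∃ s ∈ CompactSections m F E,
      ∀ x, s.1 x = (χ x : ℂ) • (trivializationAt F E x₀).symmL ℂ x v := by
  set e := trivializationAt F E x₀
  have h1 : ContMDiffOn (𝓡 m) ((𝓡 m).prod 𝓘(ℝ, F)) ∞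
      (fun x => Bundle.TotalSpace.mk' F x (e.symmL ℂ x v)) e.baseSet := by
    rw [e.contMDiffOn_section_baseSet_iff]
    refine (contMDiffOn_const (c := v)).congr fun x hx => ?_
    rw [Bundle.Trivialization.symmL_apply _ hx, e.apply_mk_symm hx]
  have h2 := ContMDiffOn.smul_section_of_tsupport (hχ.contMDiffOn (s := e.baseSet))
    e.open_baseSet hs h1
  refine ⟨⟨_, h2⟩, ?_, fun x => rfl⟩
  refine hc.of_isClosed_subset isClosed_closure (closure_mono fun x hx h0 => hx ?_)
  change χ x • e.symmL ℂ x v = 0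
  rw [h0, zero_smul]

variable [FiniteDimensional ℂ F] [SmoothHermitian m F E]
  [SecondCountableTopology M] [MeasurableSpace M] [BorelSpace M]
  {π : M → B} {g : VerticalMetric m n π} {b : B}
  [T2Space M] [T2Space B] [IsManifold (𝓡 n) ∞ B]

/-- Pushing the fibre measure forward to M reduces the claim to the fundamental lemma of the
calculus of variations on M, with the sections χ v as test objects. No manifold structure on the
fibre is needed. -/
theorem ae_inner_symmL_eq_zero (hπ : IsSurjectiveSubmersion m n π) {r : FibreL2Pre F E g b}
    (hr : ∀ (u : FibreL2 F E g b), ∀ s ∈ CompactSections m F E, IsClassOf u s →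
      ⟪u, SeparationQuotient.mk r⟫_ℂ = 0) (x₀ : M) (v : F) :
    ∀ᵐ y : Fibre π b ∂(g.vol b), y.1 ∈ (trivializationAt F E x₀).baseSet →
      ⟪(trivializationAt F E x₀).symmL ℂ y.1 v, r.1 y⟫_ℂ = 0 := by
  set e := trivializationAt F E x₀
  have hcl : IsClosed {x | π x = b} := isClosed_singleton.preimage hπ.smooth.continuous
  have hemb : MeasurableEmbedding (Subtype.val : Fibre π b → M) :=
    MeasurableEmbedding.subtype_coe hcl.measurableSet
  have : LocallyCompactSpace M := ChartedSpace.locallyCompactSpace (EuclideanSpace ℝ (Fin m)) M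
  let f : M → ℂ := Function.extend (Subtype.val : Fibre π b → M)
    (fun y => ⟪e.symmL ℂ y.1 v, r.1 y⟫_ℂ) 0
  have hf : ∀ y : Fibre π b, f y.1 = ⟪e.symmL ℂ y.1 v, r.1 y⟫_ℂ := fun y =>
    Subtype.val_injective.extend_apply _ _ y
  have key : ∀ χ : M → ℝ, ContMDiff (𝓡 m) 𝓘(ℝ, ℝ) ∞ χ → HasCompactSupport χ →
      tsupport χ ⊆ e.baseSet → Integrable (fun x => χ x • f x) ((g.vol b).map Subtype.val) ∧
        ∫ x, χ x • f x ∂((g.vol b).map Subtype.val) = 0 := by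
    intro χ hχ hc hsupp
    obtain ⟨s, hs, hsx⟩ := exists_section_cutoff x₀ v hχ hc hsupp
    obtain ⟨u, t, ht, rfl⟩ := exists_isClassOf (g := g) hπ hs b
    have hpt : ∀ y : Fibre π b, ⟪t.1 y, r.1 y⟫_ℂ = χ y.1 • f y.1 := fun y => by
      rw [ht, hsx, hf, inner_smul_left, Complex.conj_ofReal, Complex.real_smul]
    have h1 := t.integrable_inner r
    have h2 := hr _ s hs ⟨t, ht, rfl⟩
    rw [SeparationQuotient.inner_mk_mk, FibreL2Pre.inner_def] at h2
    simp only [hpt] at h1 h2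
    exact ⟨hemb.integrable_map_iff.2 h1, by rw [hemb.integral_map]; exact h2⟩
  -- Near a point f agrees with χ f for a bump function χ, and χ f is integrable as an inner product
  -- of two L² sections.
  have hloc : LocallyIntegrableOn f e.baseSet ((g.vol b).map Subtype.val) := by
    intro x hx
    obtain ⟨χ, -, hχ⟩ := (SmoothBumpFunction.nhds_basis_tsupport (I := 𝓡 m) x).mem_iff.1
      (e.open_baseSet.mem_nhds hx)
    obtain ⟨V, hV, hVo, hxV⟩ := mem_nhds_iff.1 χ.eventuallyEq_one
    refine ⟨V, mem_nhdsWithin_of_mem_nhds (hVo.mem_nhds hxV), ?_⟩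
    refine (key χ χ.contMDiff χ.hasCompactSupport hχ).1.integrableOn.congr_fun (fun y hy => ?_)
      hVo.measurableSet
    have : χ y = 1 := hV hy
    simp only [this, one_smul]
  have h := e.open_baseSet.ae_eq_zero_of_integral_contMDiff_smul_eq_zero (𝓡 m) hloc
    fun χ hχ hc hs => (key χ hχ hc hs).2
  rw [hemb.ae_map_iff] at h
  filter_upwards [h] with y hy hy'
  rw [← hf]
  exact hy hy'

/-- The restrictions of the smooth sections with compact support are dense in `L²(M_b, E_b)`. -/
theorem dense_isClassOf (hπ : IsSurjectiveSubmersion m n π) :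
    Dense {u : FibreL2 F E g b | ∃ s ∈ CompactSections m F E, IsClassOf u s} := by
  let W : Submodule ℂ (FibreL2 F E g b) :=
    { carrier := {u | ∃ s ∈ CompactSections m F E, IsClassOf u s}
      add_mem' := by
        rintro u u' ⟨s, hs, h⟩ ⟨s', hs', h'⟩
        exact ⟨s + s', add_mem hs hs', h.add h'⟩
      zero_mem' := ⟨0, zero_mem _, IsClassOf.zero⟩
      smul_mem' := by
        rintro c u ⟨s, hs, h⟩
        exact ⟨c • s, Submodule.smul_mem _ c hs, h.smul c⟩ }
  suffices Dense (W : Set (FibreL2 F E g b)) from this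
  rw [Submodule.dense_iff_topologicalClosure_eq_top, Submodule.topologicalClosure_eq_top_iff,
    Submodule.eq_bot_iff]
  intro u hu
  obtain ⟨r, rfl⟩ := SeparationQuotient.surjective_mk u
  have hr := ae_inner_symmL_eq_zero hπ (r := r) fun u s hs hus =>
    (Submodule.mem_orthogonal W _).1 hu u ⟨s, hs, hus⟩
  -- Countably many trivialisations cover M and F has a finite basis, so the exceptional null sets
  -- have a null union.
  obtain ⟨S, hS, hcov⟩ := TopologicalSpace.countable_cover_nhds
    (f := fun x₀ : M => (trivializationAt F E x₀).baseSet)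
    (fun x₀ => (trivializationAt F E x₀).open_baseSet.mem_nhds
      (FiberBundle.mem_baseSet_trivializationAt' x₀))
  let bF := Module.finBasis ℂ F
  have h1 : ∀ᵐ y : Fibre π b ∂(g.vol b), ∀ x₀ ∈ S, ∀ i,
      y.1 ∈ (trivializationAt F E x₀).baseSet →
      ⟪(trivializationAt F E x₀).symmL ℂ y.1 (bF i), r.1 y⟫_ℂ = 0 :=
    (ae_ball_iff hS).2 fun x₀ _ => ae_all_iff.2 fun i => hr x₀ (bF i)
  have h2 : ∀ᵐ y : Fibre π b ∂(g.vol b), ‖r.1 y‖ ^ 2 = 0 := by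
    filter_upwards [h1] with y hy
    have : y.1 ∈ ⋃ x ∈ S, (trivializationAt F E x).baseSet := by rw [hcov]; trivial
    obtain ⟨x₀, hx₀, hyx⟩ := Set.mem_iUnion₂.1 this
    set e := trivializationAt F E x₀
    have h3 : r.1 y = ∑ i, bF.repr (e.continuousLinearMapAt ℂ y.1 (r.1 y)) i •
        e.symmL ℂ y.1 (bF i) := by
      conv_lhs => rw [← e.symmL_continuousLinearMapAt (R := ℂ) hyx (r.1 y),
        ← bF.sum_repr (e.continuousLinearMapAt ℂ y.1 (r.1 y))]
      simp only [map_sum, map_smul]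
    have h4 : ⟪r.1 y, r.1 y⟫_ℂ = 0 := by
      conv_lhs => rw [h3]
      rw [sum_inner]
      refine Finset.sum_eq_zero fun i _ => ?_
      rw [inner_smul_left]
      conv_lhs => rw [← h3]
      rw [hy x₀ hx₀ i hyx, mul_zero]
    rw [inner_self_eq_zero.1 h4, norm_zero, zero_pow two_ne_zero]
  have h5 : ‖r‖ ^ 2 = 0 := by
    rw [r.norm_sq]
    exact integral_eq_zero_of_ae h2
  rw [← norm_eq_zero, SeparationQuotient.norm_mk]
  exact pow_eq_zero_iff two_ne_zero |>.1 h5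

end Density

/-- Multiplication by a function with values in `[0, 1]` on bounded families. -/
def mulLp {B : Type*} {H : B → Type*} [∀ b, NormedAddCommGroup (H b)]
    [∀ b, InnerProductSpace ℂ (H b)] (f : B → ℝ) (hf : ∀ b, f b ∈ Set.Icc (0 : ℝ) 1) :
    lp H ⊤ →L[ℂ] lp H ⊤ :=
  have h : ∀ (ψ : lp H ⊤) b, ‖(f b : ℂ) • ψ b‖ ≤ ‖ψ‖ := fun ψ b => by
    rw [norm_smul, Complex.norm_real, Real.norm_of_nonneg (hf b).1]
    exact (mul_le_of_le_one_left (norm_nonneg _) (hf b).2).trans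
      (lp.norm_apply_le_norm ENNReal.top_ne_zero ψ b)
  LinearMap.mkContinuous
    { toFun := fun ψ => ⟨fun b => (f b : ℂ) • ψ b, memℓp_infty ⟨‖ψ‖, by
        rintro _ ⟨b, rfl⟩
        exact h ψ b⟩⟩
      map_add' := fun ψ ψ' => lp.ext (funext fun b => smul_add _ _ _)
      map_smul' := fun c ψ => lp.ext (funext fun b => smul_comm _ _ _) } 1 fun ψ => by
    rw [one_mul]
    exact lp.norm_le_of_forall_le (norm_nonneg _) fun b => h ψ b

/-! ### The module Γ_0(B, E_•) and the operator D on it. -/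

section Operator

variable {m n : ℕ} {M B : Type*}
  [TopologicalSpace M] [T2Space M] [SecondCountableTopology M]
  [ChartedSpace (EuclideanSpace ℝ (Fin m)) M] [IsManifold (𝓡 m) ∞ M]
  [TopologicalSpace B] [T2Space B]
  [ChartedSpace (EuclideanSpace ℝ (Fin n)) B] [IsManifold (𝓡 n) ∞ B]
  [MeasurableSpace M] [BorelSpace M]
  {F : Type*} [NormedAddCommGroup F] [NormedSpace ℂ F] [FiniteDimensional ℂ F]
  {E : M → Type*} [TopologicalSpace (Bundle.TotalSpace F E)]
  [∀ x, NormedAddCommGroup (E x)] [∀ x, InnerProductSpace ℂ (E x)]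
  [FiberBundle F E] [VectorBundle ℂ F E] [VectorBundle ℝ F E]
  [SmoothHermitian m F E]
  {π : M → B} {g : VerticalMetric m n π}

/-- The element of the section module given by a smooth section with compact support. -/
theorem exists_sectionModule_isClassOf (hπ : IsSurjectiveSubmersion m n π)
    {s : SmoothSections m F E} (hs : s ∈ CompactSections m F E) :
    ∃ ψ : SectionModule F E g, ∀ b, IsClassOf (ψ.1 b) s := by
  choose u hu using fun b => exists_isClassOf (g := g) hπ hs b
  obtain ⟨N, hN, hNu, hNc⟩ := exists_continuous_norm (g := g) hπ hs
  have hb : Memℓp u ⊤ := memℓp_infty (by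
    simp only [fun b => hNu b (u b) (hu b)]
    exact hN.bddAbove_range_of_hasCompactSupport hNc)
  exact ⟨⟨⟨u, hb⟩, Submodule.le_topologicalClosure _ ⟨s, hs, hu⟩⟩, hu⟩

theorem dense_isClassOf_sectionModule : Dense {ψ : SectionModule F E g |
    ∃ s ∈ CompactSections m F E, ∀ b, IsClassOf (ψ.1 b) s} := by
  refine Subtype.dense_iff.2 fun ψ hψ => ?_
  have h : ψ ∈ closure {ψ : lp (fun b => FibreL2 F E g b) ⊤ |
    ∃ s ∈ CompactSections m F E, ∀ b, IsClassOf (ψ b) s} := hψ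
  refine closure_mono ?_ h
  rintro η ⟨s, hs, hη⟩
  exact ⟨⟨η, Submodule.le_topologicalClosure _ ⟨s, hs, hη⟩⟩, ⟨s, hs, hη⟩, rfl⟩

theorem mulLp_mem_sectionModule (hπ : IsSurjectiveSubmersion m n π) {f : B → ℝ}
    (hf : ContMDiff (𝓡 n) 𝓘(ℝ, ℝ) ∞ f) (hf' : ∀ b, f b ∈ Set.Icc (0 : ℝ) 1)
    {ψ : lp (fun b => FibreL2 F E g b) ⊤} (hψ : ψ ∈ SectionModule F E g) :
    mulLp f hf' ψ ∈ SectionModule F E g := by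
  refine map_mem_closure (mulLp f hf').continuous hψ ?_
  rintro η ⟨s, hs, hη⟩
  exact ⟨fmul (f ∘ π) (hf.comp hπ.smooth) s, fmul_mem_compactSections _ _ hs,
    fun b => (hη b).fmul _⟩

variable [ContMDiffVectorBundle ∞ F E (𝓡 m)]

/-- Norm functions of elements of the completion are uniform limits of those of compactly supported
smooth sections, which are continuous by fibre integration. -/
theorem isSmoothModule_sectionModule (hπ : IsSurjectiveSubmersion m n π) :
    IsSmoothModule n (SectionModule F E g) where
  isClosed := Submodule.isClosed_topologicalClosure _
  exists_smul f hf hf' ψ :=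
    ⟨⟨mulLp f hf' ψ.1, mulLp_mem_sectionModule hπ hf hf' ψ.2⟩, fun b => rfl⟩
  continuous_norm ψ := by
    refine continuous_of_uniform_approx_of_continuous fun U hU => ?_
    obtain ⟨ε, hε, hεU⟩ := Metric.mem_uniformity_dist.1 hU
    obtain ⟨η, hd, s, hs, hη⟩ := Metric.dense_iff.1 dense_isClassOf_sectionModule ψ ε hε
    obtain ⟨N, hN, hNu, -⟩ := exists_continuous_norm (g := g) hπ hs
    refine ⟨N, hN, fun b => hεU ?_⟩
    rw [← hNu b _ (hη b), dist_comm, Real.dist_eq]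
    refine (abs_norm_sub_norm_le _ _).trans_lt (lt_of_le_of_lt ?_ hd)
    rw [dist_eq_norm]
    exact lp.norm_apply_le_norm ENNReal.top_ne_zero (η - ψ).1 b
  dense_compact_support := by
    refine dense_isClassOf_sectionModule.mono ?_
    rintro η ⟨s, hs, hη⟩
    obtain ⟨N, -, hNu, hNc⟩ := exists_continuous_norm (g := g) hπ hs
    refine ⟨tsupport N, hNc, fun b hb => ?_⟩
    rw [← norm_eq_zero, hNu b _ (hη b), image_eq_zero_of_notMem_tsupport hb]
  denseRange_ev b := by
    refine (dense_isClassOf hπ).mono ?_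
    rintro u ⟨s, hs, hu⟩
    obtain ⟨ψ, hψ⟩ := exists_sectionModule_isClassOf (g := g) hπ hs
    exact ⟨ψ, (hψ b).unique hu⟩

variable {D : SmoothSections m F E →ₗ[ℂ] SmoothSections m F E}

theorem IsFibrewiseSymmetric.inner_eq (hD : IsFibrewiseSymmetric g D)
    {s t : SmoothSections m F E} (hs : s ∈ CompactSections m F E) (ht : t ∈ CompactSections m F E)
    {b : B} {u u' v v' : FibreL2 F E g b} (hu : IsClassOf u s) (hu' : IsClassOf u' (D s))
    (hv : IsClassOf v t) (hv' : IsClassOf v' (D t)) : ⟪u', v⟫_ℂ = ⟪u, v'⟫_ℂ := by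
  rw [hu'.inner_eq hv, hu.inner_eq hv']
  exact hD s hs t ht b

/-- Symmetry makes D descend to fibres: if s vanishes in L²(M_b), then D s pairs to zero with a
dense set there. This makes the graphs of `fibreOperator` and `moduleOperator` single-valued. -/
theorem IsFibrewiseSymmetric.eq_zero (hD : IsFibrewiseSymmetric g D)
    (hπ : IsSurjectiveSubmersion m n π) (hD₁ : IsFirstOrder D)
    {s : SmoothSections m F E} (hs : s ∈ CompactSections m F E) {b : B} {u : FibreL2 F E g b}
    (h0 : IsClassOf (0 : FibreL2 F E g b) s) (hu : IsClassOf u (D s)) : u = 0 := by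
  refine (dense_isClassOf hπ).eq_zero_of_inner_left ℂ ?_
  rintro v ⟨t, ht, hv⟩
  obtain ⟨v', hv'⟩ := exists_isClassOf (g := g) hπ (hD₁.map_compactSections ht) b
  rw [hD.inner_eq hs ht h0 hu hv hv', inner_zero_left]

theorem mem_graph_fibreOperator (hπ : IsSurjectiveSubmersion m n π) (hD₁ : IsFirstOrder D)
    (hD : IsFibrewiseSymmetric g D) {b : B} {p : FibreL2 F E g b × FibreL2 F E g b} :
    p ∈ (fibreOperator g D b).graph ↔
      ∃ s ∈ CompactSections m F E, IsClassOf p.1 s ∧ IsClassOf p.2 (D s) := by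
  unfold fibreOperator
  rw [Submodule.toLinearPMap_graph_eq]
  · rfl
  · rintro q ⟨s, hs, h1, h2⟩ h0
    rw [h0] at h1
    exact hD.eq_zero hπ hD₁ hs h1 h2

theorem mem_graph_moduleOperator (hπ : IsSurjectiveSubmersion m n π) (hD₁ : IsFirstOrder D)
    (hD : IsFibrewiseSymmetric g D) {p : SectionModule F E g × SectionModule F E g} :
    p ∈ (moduleOperator g D).graph ↔
      ∃ s ∈ CompactSections m F E, ∀ b, IsClassOf (p.1.1 b) s ∧ IsClassOf (p.2.1 b) (D s) := by
  unfold moduleOperator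
  rw [Submodule.toLinearPMap_graph_eq]
  · rfl
  · rintro q ⟨s, hs, h⟩ h0
    ext b
    refine hD.eq_zero hπ hD₁ hs ?_ (h b).2
    have := (h b).1
    rwa [h0] at this

theorem exists_mem_graph_moduleOperator (hπ : IsSurjectiveSubmersion m n π) (hD₁ : IsFirstOrder D)
    (hD : IsFibrewiseSymmetric g D) {s : SmoothSections m F E} (hs : s ∈ CompactSections m F E) :
    ∃ p ∈ (moduleOperator g D).graph,
      ∀ b, IsClassOf (p.1.1 b) s ∧ IsClassOf (p.2.1 b) (D s) := by
  obtain ⟨ψ, hψ⟩ := exists_sectionModule_isClassOf (g := g) hπ hs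
  obtain ⟨η, hη⟩ := exists_sectionModule_isClassOf (g := g) hπ (hD₁.map_compactSections hs)
  exact ⟨(ψ, η), (mem_graph_moduleOperator hπ hD₁ hD).2 ⟨s, hs, fun b => ⟨hψ b, hη b⟩⟩,
    fun b => ⟨hψ b, hη b⟩⟩

theorem dense_domain_fibreOperator (hπ : IsSurjectiveSubmersion m n π) (hD₁ : IsFirstOrder D)
    (hD : IsFibrewiseSymmetric g D) (b : B) :
    Dense ((fibreOperator g D b).domain : Set (FibreL2 F E g b)) := by
  refine (dense_isClassOf hπ).mono ?_
  rintro u ⟨s, hs, hu⟩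
  obtain ⟨v, hv⟩ := exists_isClassOf (g := g) hπ (hD₁.map_compactSections hs) b
  exact LinearPMap.mem_domain_of_mem_graph
    ((mem_graph_fibreOperator hπ hD₁ hD (p := (u, v))).2 ⟨s, hs, hu, hv⟩)

theorem dense_domain_moduleOperator (hπ : IsSurjectiveSubmersion m n π) (hD₁ : IsFirstOrder D)
    (hD : IsFibrewiseSymmetric g D) :
    Dense ((moduleOperator g D).domain : Set (SectionModule F E g)) := by
  refine dense_isClassOf_sectionModule.mono ?_
  rintro ψ ⟨s, hs, hψ⟩
  obtain ⟨η, hη⟩ := exists_sectionModule_isClassOf (g := g) hπ (hD₁.map_compactSections hs)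
  exact LinearPMap.mem_domain_of_mem_graph
    ((mem_graph_moduleOperator hπ hD₁ hD (p := (ψ, η))).2 ⟨s, hs, fun b => ⟨hψ b, hη b⟩⟩)

theorem dense_map_domain_moduleOperator (hπ : IsSurjectiveSubmersion m n π)
    (hD₁ : IsFirstOrder D) (hD : IsFibrewiseSymmetric g D) (b : B) :
    Dense ((moduleOperator g D).domain.map (ev (SectionModule F E g) b) :
      Set (FibreL2 F E g b)) := by
  refine (dense_isClassOf hπ).mono ?_
  rintro u ⟨s, hs, hu⟩
  obtain ⟨p, hp, hps⟩ := exists_mem_graph_moduleOperator hπ hD₁ hD hs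
  exact ⟨p.1, LinearPMap.mem_domain_of_mem_graph hp, (hps b).1.unique hu⟩

/-- By symmetry the operator is contained in its adjoint, which is closed. -/
theorem isClosable_fibreOperator (hπ : IsSurjectiveSubmersion m n π) (hD₁ : IsFirstOrder D)
    (hD : IsFibrewiseSymmetric g D) (b : B) : (fibreOperator g D b).IsClosable := by
  have hd := dense_domain_fibreOperator hπ hD₁ hD b
  refine (isClosed_hilbertAdjoint hd).isClosable.leIsClosable
    (LinearPMap.le_of_le_graph fun p hp => ?_)
  obtain ⟨s, hs, h1, h2⟩ := (mem_graph_fibreOperator hπ hD₁ hD).1 hp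
  refine (mem_graph_hilbertAdjoint hd).2 fun x => ?_
  obtain ⟨t, ht, h3, h4⟩ :=
    (mem_graph_fibreOperator hπ hD₁ hD).1 ((fibreOperator g D b).mem_graph x)
  exact hD.inner_eq ht hs h3 h4 h1 h2

theorem isClosable_moduleOperator (hπ : IsSurjectiveSubmersion m n π) (hD₁ : IsFirstOrder D)
    (hD : IsFibrewiseSymmetric g D) : (moduleOperator g D).IsClosable := by
  have hd := dense_map_domain_moduleOperator hπ hD₁ hD
  refine (isClosed_moduleAdjoint hd).isClosable.leIsClosable
    (LinearPMap.le_of_le_graph fun p hp => ?_)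
  obtain ⟨s, hs, h⟩ := (mem_graph_moduleOperator hπ hD₁ hD).1 hp
  refine (mem_graph_moduleAdjoint hd).2 fun x b => ?_
  obtain ⟨t, ht, h'⟩ :=
    (mem_graph_moduleOperator hπ hD₁ hD).1 ((moduleOperator g D).mem_graph x)
  exact hD.inner_eq ht hs (h' b).1 (h' b).2 (h b).1 (h b).2

theorem coe_graph_closure_moduleOperator (hπ : IsSurjectiveSubmersion m n π)
    (hD₁ : IsFirstOrder D) (hD : IsFibrewiseSymmetric g D) :
    ((moduleOperator g D).closure.graph : Set (SectionModule F E g × SectionModule F E g)) =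
      closure ((moduleOperator g D).graph : Set (SectionModule F E g × SectionModule F E g)) := by
  rw [← (isClosable_moduleOperator hπ hD₁ hD).graph_closure_eq_closure_graph]
  rfl

/-- On smooth sections the two graphs match after evaluation at b, and since evaluation is
continuous, first closing in the module adds nothing to the closure in the fibre. -/
theorem isFibrewiseClosure_closure_moduleOperator (hπ : IsSurjectiveSubmersion m n π)
    (hD₁ : IsFirstOrder D) (hD : IsFibrewiseSymmetric g D) :
    IsFibrewiseClosure (moduleOperator g D).closure fun b => (fibreOperator g D b).closure := by
  intro b
  rw [← (isClosable_fibreOperator hπ hD₁ hD b).graph_closure_eq_closure_graph,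
    Submodule.topologicalClosure_coe, coe_graph_closure_moduleOperator hπ hD₁ hD]
  refine (closure_mono ?_).antisymm (closure_minimal ?_ isClosed_closure)
  · rintro q hq
    obtain ⟨s, hs, h1, h2⟩ := (mem_graph_fibreOperator hπ hD₁ hD).1 hq
    obtain ⟨p, hp, hps⟩ := exists_mem_graph_moduleOperator hπ hD₁ hD hs
    exact ⟨p, subset_closure hp, Prod.ext ((hps b).1.unique h1) ((hps b).2.unique h2)⟩
  · rintro _ ⟨p, hp, rfl⟩
    refine map_mem_closure (f := fun p : SectionModule F E g × SectionModule F E g =>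
      (p.1.1 b, p.2.1 b)) (((continuous_eval_lp _ b).comp continuous_fst).prodMk
        ((continuous_eval_lp _ b).comp continuous_snd)) hp fun q hq => ?_
    obtain ⟨s, hs, h⟩ := (mem_graph_moduleOperator hπ hD₁ hD).1 hq
    exact (mem_graph_fibreOperator hπ hD₁ hD).2 ⟨s, hs, h b⟩

theorem dense_domain_closure_moduleOperator (hπ : IsSurjectiveSubmersion m n π)
    (hD₁ : IsFirstOrder D) (hD : IsFibrewiseSymmetric g D) :
    Dense ((moduleOperator g D).closure.domain : Set (SectionModule F E g)) :=
  (dense_domain_moduleOperator hπ hD₁ hD).mono (LinearPMap.le_closure _).1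

/-- Symmetry passes to the closure in one argument, so the adjoint of the closure still extends D on
smooth sections of compact support. -/
theorem dense_domain_adjoint_closure_moduleOperator (hπ : IsSurjectiveSubmersion m n π)
    (hD₁ : IsFirstOrder D) (hD : IsFibrewiseSymmetric g D) :
    Dense ((moduleAdjoint (moduleOperator g D).closure).domain : Set (SectionModule F E g)) := by
  have hd : ∀ b, Dense ((moduleOperator g D).closure.domain.map (ev (SectionModule F E g) b) :
      Set (FibreL2 F E g b)) := fun b =>
    (dense_map_domain_moduleOperator hπ hD₁ hD b).mono
      (Submodule.map_mono (LinearPMap.le_closure _).1)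
  refine (dense_domain_moduleOperator hπ hD₁ hD).mono fun ψ hψ => ?_
  refine LinearPMap.mem_domain_of_mem_graph (y := moduleOperator g D ⟨ψ, hψ⟩)
    ((mem_graph_moduleAdjoint hd).2 fun φ b => ?_)
  obtain ⟨s, hs, h⟩ :=
    (mem_graph_moduleOperator hπ hD₁ hD).1 ((moduleOperator g D).mem_graph ⟨ψ, hψ⟩)
  have hφ : ((φ : SectionModule F E g), (moduleOperator g D).closure φ) ∈
      closure ((moduleOperator g D).graph : Set (SectionModule F E g × SectionModule F E g)) := by
    rw [← coe_graph_closure_moduleOperator hπ hD₁ hD]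
    exact LinearPMap.mem_graph _ φ
  refine closure_minimal (t := {q : SectionModule F E g × SectionModule F E g |
    ⟪q.2.1 b, ψ.1 b⟫_ℂ = ⟪q.1.1 b, (moduleOperator g D ⟨ψ, hψ⟩).1 b⟫_ℂ}) ?_ ?_ hφ
  · intro q hq
    obtain ⟨t, ht, h'⟩ := (mem_graph_moduleOperator hπ hD₁ hD).1 hq
    exact hD.inner_eq ht hs (h' b).1 (h' b).2 (h b).1 (h b).2
  · exact isClosed_eq
      (((continuous_eval_lp _ b).comp continuous_snd).inner continuous_const)
      (((continuous_eval_lp _ b).comp continuous_fst).inner continuous_const)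

/-- Multiplication by f is continuous on the module and, by C^∞(B)-linearity of D, preserves the
graph on smooth sections; hence it preserves the closure. -/
theorem exists_smul_mem_graph_closure_moduleOperator (hπ : IsSurjectiveSubmersion m n π)
    (hD₁ : IsFirstOrder D) (hD : IsFibrewiseSymmetric g D) (hv : IsVertical n π D) (f : B → ℝ)
    (hf : ContMDiff (𝓡 n) 𝓘(ℝ, ℝ) ∞ f) (hf' : ∀ b, f b ∈ Set.Icc (0 : ℝ) 1)
    (p : SectionModule F E g × SectionModule F E g)
    (hp : p ∈ (moduleOperator g D).closure.graph) :
    ∃ q ∈ (moduleOperator g D).closure.graph,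
      ∀ b, q.1.1 b = (f b : ℂ) • p.1.1 b ∧ q.2.1 b = (f b : ℂ) • p.2.1 b := by
  let L : SectionModule F E g → SectionModule F E g := fun ψ =>
    ⟨mulLp f hf' ψ.1, mulLp_mem_sectionModule hπ hf hf' ψ.2⟩
  have hL : Continuous L := ((mulLp f hf').continuous.comp continuous_subtype_val).subtype_mk _
  refine ⟨(L p.1, L p.2), ?_, fun b => ⟨rfl, rfl⟩⟩
  rw [← SetLike.mem_coe, coe_graph_closure_moduleOperator hπ hD₁ hD] at hp ⊢
  refine map_mem_closure (f := Prod.map L L) (hL.prodMap hL) hp fun q hq => ?_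
  obtain ⟨s, hs, h⟩ := (mem_graph_moduleOperator hπ hD₁ hD).1 hq
  have hfπ : ContMDiff (𝓡 m) 𝓘(ℝ, ℝ) ∞ (f ∘ π) := hf.comp hπ.smooth
  refine (mem_graph_moduleOperator hπ hD₁ hD).2
    ⟨fmul (f ∘ π) hfπ s, fmul_mem_compactSections _ _ hs, fun b => ⟨(h b).1.fmul _, ?_⟩⟩
  rw [hv f hf hfπ s]
  exact (h b).2.fmul _

end Operator

end VerticalOperator

end

theorem mainTheorem7 {m n : ℕ} {M B : Type*}
    -- `M` and `B` are smooth manifolds without boundary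
    [TopologicalSpace M] [T2Space M] [SecondCountableTopology M]
    [ChartedSpace (EuclideanSpace ℝ (Fin m)) M] [IsManifold (𝓡 m) ∞ M]
    [TopologicalSpace B] [T2Space B] [SecondCountableTopology B]
    [ChartedSpace (EuclideanSpace ℝ (Fin n)) B] [IsManifold (𝓡 n) ∞ B]
    [MeasurableSpace M] [BorelSpace M]
    -- `E` is a smooth complex vector bundle over `M` with a smooth hermitian structure
    {F : Type*} [NormedAddCommGroup F] [NormedSpace ℂ F] [FiniteDimensional ℂ F]
    {E : M → Type*} [TopologicalSpace (Bundle.TotalSpace F E)]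
    [∀ x, NormedAddCommGroup (E x)] [∀ x, InnerProductSpace ℂ (E x)]
    [FiberBundle F E] [VectorBundle ℂ F E] [VectorBundle ℝ F E]
    [ContMDiffVectorBundle ∞ F E (𝓡 m)] [SmoothHermitian m F E]
    -- `π` is a submersion with a smooth vertical metric
    (π : M → B) (hπ : IsSurjectiveSubmersion m n π) (g : VerticalMetric m n π)
    -- `D` is a vertically elliptic, symmetric, first-order differential operator
    (D : SmoothSections m F E →ₗ[ℂ] SmoothSections m F E)
    (hD_first : IsFirstOrder D) (hD_elliptic : IsVerticallyElliptic n π D)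
    (hD_symm : IsFibrewiseSymmetric g D) :
    List.TFAE [
      IsRegular (moduleOperator g D).closure,
      ∀ b : B, (hilbertAdjoint (fibreOperator g D b).closure).HasCore
        ((moduleAdjoint (moduleOperator g D).closure).domain.map (ev (SectionModule F E g) b)),
      ∀ b : B, (moduleAdjoint (moduleOperator g D).closure).domain.map (ev (SectionModule F E g) b)
        = (hilbertAdjoint (fibreOperator g D b).closure).domain] := by
  exact (isSmoothModule_sectionModule hπ).isRegular_tfae
    (isFibrewiseClosure_closure_moduleOperator hπ hD_first hD_symm)
    (isClosable_moduleOperator hπ hD_first hD_symm).closure_isClosed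
    (dense_domain_closure_moduleOperator hπ hD_first hD_symm)
    (dense_domain_adjoint_closure_moduleOperator hπ hD_first hD_symm)
    (exists_smul_mem_graph_closure_moduleOperator hπ hD_first hD_symm hD_elliptic.1)
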